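/- Let $\mathbf{k}$ be an algebraically closed field of characteristic $0$, let $U=\mathbf{k}^2$, let $d\ge 0$ and let $\lambda$ be a partition of $d$. Let $$A=\bigoplus_{m\ge 0} A_m,\qquad A_m=(\operatorname{Sym}^m U)^{\otimes d},$$ with its natural action of $\mathbf{GL}(U)$ and with the symmetric group $\mathfrak{S}_d$ permuting the tensor factors. Let $V_\lambda=\mathbf{k}[\mathfrak{S}_d]\,c_\lambda$ be the irreducible $\mathfrak{S}_d$-representation indexed by $\lambda$, where $c_\lambda$ is a Young symmetrizer of shape $\lambda$ (so $V_{(d)}$ is trivial and $V_{(1^d)}$ is the sign representation). Let $M_\lambda=\operatorname{Hom}_{\mathfrak{S}_d}(V_\lambda,A)$ be the module of $\lambda$-covariants, graded by $(M_\lambda)_m=\operatorname{Hom}_{\mathfrak{S}_d}(V_\lambda,A_m)$. For a polynomial representation $L$ of $\mathbf{GL}(U)$ of degree $e$, put $\operatorname{ch}(L)=\sum_{i=0}^{e}\dim(L_{i,e-i})\,q^i$, where $L_{i,j}$ is the subspace on which $\operatorname{diag}(t_1,t_2)$ acts as $t_1^it_2^j$ for all $t_1,t_2\in\mathbf{k}^*$.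 The component $(M_\lambda)_m$ is a polynomial representation of degree $dm$, and the equivariant Hilbert series of $M_\lambda$ is $\mathrm{H}_{M_\lambda}(t)=\sum_{m\ge 0}\operatorname{ch}((M_\lambda)_m)\,t^m$. Then, in $\mathbf{Z}[q][[t]]$, $$\mathrm{H}_{M_\lambda}(t)=\sum_{m\ge 0}s_\lambda(1,q,\dots,q^m)\,t^m=\frac{\sum_{T\in\mathrm{SYT}(\lambda)}t^{\mathrm{des}(T)}q^{\mathrm{maj}(T)}}{(1-t)(1-qt)\cdots(1-q^dt)}.$$ Here $s_\lambda(x_0,\dots,x_m)$ is the Schur polynomial, that is, the sum of the monomials $\prod_{c\in\lambda}x_{S(c)}$ over all semistandard tableaux $S$ of shape $\lambda$ with entries in $\{0,\dots,m\}$. Further, $\mathrm{SYT}(\lambda)$ is the set of standard Young tableaux of shape $\lambda$ with entries $1,\dots,d$, a descent of $T$ is an $i$ such that $i+1$ appears in a lower row of $T$ than $i$ (rows are numbered from top to bottom), $\mathrm{des}(T)$ is the number of descents of $T$, and $\mathrm{maj}(T)$ is the sum of the descents of $T$. -/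

import Mathlib

open scoped DirectSum

namespace Covariants

noncomputable section

/-! ### The rings and their group actions

Throughout, `U = k^(n+1)` with its standard basis, so that `GL(U)` is the matrix group. -/

/-- The ring `Sym(U ⊕ ⋯ ⊕ U)` (`d` summands): polynomials in the variables `u^{(i)}_j = X (i, j)`,
where `u^{(i)}_0, …, u^{(i)}_n` is the standard basis of the `i`-th copy of `U`. -/
abbrev CoordRing (k : Type*) [Field k] (d n : ℕ) : Type _ :=
  MvPolynomial (Fin d × Fin (n + 1)) k

/-- The linear substitution given by a matrix `g`, acting on every copy of `U` by
`u_j ↦ ∑ l, g l j • u_l` (the `j`-th column of `g`). -/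
def glSubst {k : Type*} [Field k] {d n : ℕ} (g : Matrix (Fin (n + 1)) (Fin (n + 1)) k) :
    CoordRing k d n →ₐ[k] CoordRing k d n :=
  MvPolynomial.aeval fun p => ∑ l, MvPolynomial.C (g l p.2) * MvPolynomial.X (p.1, l)

/-- The action of `GL(U)` on `Sym(U ⊕ ⋯ ⊕ U)` by algebra automorphisms. -/
def glRep (k : Type*) [Field k] (d n : ℕ) :
    Representation k (Matrix.GeneralLinearGroup (Fin (n + 1)) k) (CoordRing k d n) where
  toFun g := (glSubst (g : Matrix (Fin (n + 1)) (Fin (n + 1)) k)).toLinearMap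
  map_one' := by
    have h : glSubst (1 : Matrix (Fin (n + 1)) (Fin (n + 1)) k) = AlgHom.id k (CoordRing k d n) := by
      ext1 p
      simp [glSubst, Matrix.one_apply, apply_ite (MvPolynomial.C (σ := Fin d × Fin (n + 1)) (R := k)),
        ite_mul]
    rw [Units.val_one, h]
    rfl
  map_mul' g h := by
    have H : glSubst ((g : Matrix (Fin (n + 1)) (Fin (n + 1)) k) *
        (h : Matrix (Fin (n + 1)) (Fin (n + 1)) k)) =
        (glSubst (d := d) (g : Matrix (Fin (n + 1)) (Fin (n + 1)) k)).comp
          (glSubst (h : Matrix (Fin (n + 1)) (Fin (n + 1)) k)) := by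
      ext1 p
      simp only [glSubst, MvPolynomial.aeval_X, AlgHom.comp_apply, map_sum, map_mul,
        MvPolynomial.algHom_C, Matrix.mul_apply, MvPolynomial.algebraMap_eq, Finset.sum_mul,
        Finset.mul_sum]
      rw [Finset.sum_comm]
      refine Finset.sum_congr rfl fun a _ => Finset.sum_congr rfl fun b _ => ?_
      ring
    rw [Units.val_mul, H]
    rfl

/-- The action of the symmetric group on `Sym(U ⊕ ⋯ ⊕ U) = Sym(U) ⊗ ⋯ ⊗ Sym(U)` by permuting the
tensor factors. -/
def permRep (k : Type*) [Field k] (d n : ℕ) :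
    Representation k (Equiv.Perm (Fin d)) (CoordRing k d n) where
  toFun σ := (MvPolynomial.rename (Prod.map σ id)).toLinearMap
  map_one' := by
    refine LinearMap.ext fun p => ?_
    change MvPolynomial.rename (Prod.map (fun x => x) id) p = p
    exact MvPolynomial.rename_id_apply p
  map_mul' σ τ := by
    refine LinearMap.ext fun p => ?_
    exact (MvPolynomial.rename_rename (Prod.map τ id) (Prod.map σ id) p).symm

/-- The weights defining the `ℤ^d`-grading: `u^{(i)}_j` has degree the `i`-th unit vector. -/
def multiWeight (d n : ℕ) (p : Fin d × Fin (n + 1)) : Fin d → ℕ := Pi.single p.1 1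

/-- The component of multidegree `(m, …, m)`, that is `Sym^m U ⊗ ⋯ ⊗ Sym^m U`. -/
def segrePiece (k : Type*) [Field k] (d n m : ℕ) : Submodule k (CoordRing k d n) :=
  MvPolynomial.weightedHomogeneousSubmodule k (multiWeight d n) (fun _ => m)

theorem glSubst_isWeightedHomogeneous {k : Type*} [Field k] {d n : ℕ}
    (g : Matrix (Fin (n + 1)) (Fin (n + 1)) k) {e : Fin d → ℕ} {p : CoordRing k d n}
    (hp : MvPolynomial.IsWeightedHomogeneous (multiWeight d n) p e) :
    MvPolynomial.IsWeightedHomogeneous (multiWeight d n) (glSubst g p) e := by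
  classical
  rw [p.as_sum, map_sum]
  refine MvPolynomial.IsWeightedHomogeneous.sum _ _ _ fun s hs => ?_
  have hw : Finsupp.weight (multiWeight d n) s = e := hp (MvPolynomial.mem_support_iff.mp hs)
  rw [glSubst, MvPolynomial.aeval_monomial, MvPolynomial.algebraMap_eq]
  refine MvPolynomial.IsWeightedHomogeneous.C_mul ?_ _
  rw [← hw, Finsupp.weight_apply]
  refine MvPolynomial.IsWeightedHomogeneous.prod _ _ _ fun q _ => ?_
  refine MvPolynomial.IsWeightedHomogeneous.pow ?_ _
  refine MvPolynomial.IsWeightedHomogeneous.sum _ _ _ fun l _ => ?_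
  exact MvPolynomial.IsWeightedHomogeneous.C_mul
    (MvPolynomial.isWeightedHomogeneous_X k (multiWeight d n) (q.1, l)) _

theorem rename_isWeightedHomogeneous {k : Type*} [Field k] {d n m : ℕ}
    (σ : Equiv.Perm (Fin d)) {p : CoordRing k d n}
    (hp : MvPolynomial.IsWeightedHomogeneous (multiWeight d n) p (fun _ => m)) :
    MvPolynomial.IsWeightedHomogeneous (multiWeight d n)
      (MvPolynomial.rename (Prod.map σ id) p) (fun _ => m) := by
  classical
  rw [p.as_sum, map_sum]
  refine MvPolynomial.IsWeightedHomogeneous.sum _ _ _ fun s hs => ?_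
  have hw : Finsupp.weight (multiWeight d n) s = fun _ => m :=
    hp (MvPolynomial.mem_support_iff.mp hs)
  rw [MvPolynomial.rename_monomial]
  refine MvPolynomial.isWeightedHomogeneous_monomial _ _ _ ?_
  rw [Finsupp.weight_apply, Finsupp.sum_mapDomain_index (by simp) (by simp [add_smul])]
  funext i
  have hi := congrFun hw (σ.symm i)
  rw [Finsupp.weight_apply, Finsupp.sum, Finset.sum_apply] at hi
  rw [Finsupp.sum, Finset.sum_apply, ← hi]
  refine Finset.sum_congr rfl fun q _ => ?_
  simp [multiWeight, Pi.single_apply, Equiv.symm_apply_eq]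

/-- `GL(U)` acting on `Sym^m U ⊗ ⋯ ⊗ Sym^m U`. -/
def glRepPiece (k : Type*) [Field k] (d n m : ℕ) :
    Representation k (Matrix.GeneralLinearGroup (Fin (n + 1)) k) (segrePiece k d n m) :=
  (glRep k d n).subrepresentation (segrePiece k d n m) fun g _ hp =>
    glSubst_isWeightedHomogeneous (g : Matrix (Fin (n + 1)) (Fin (n + 1)) k) hp

/-- The symmetric group acting on `Sym^m U ⊗ ⋯ ⊗ Sym^m U`. -/
def permRepPiece (k : Type*) [Field k] (d n m : ℕ) :
    Representation k (Equiv.Perm (Fin d)) (segrePiece k d n m) :=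
  (permRep k d n).subrepresentation (segrePiece k d n m) fun σ _ hp =>
    rename_isWeightedHomogeneous σ hp

/-- `A = ⨁_{m ≥ 0} Sym^m U ⊗ ⋯ ⊗ Sym^m U` (`d` tensor factors). -/
abbrev SegreRing (k : Type*) [Field k] (d n : ℕ) : Type _ := ⨁ m : ℕ, segrePiece k d n m

/-- The action of `GL(U)` on `A`. -/
def glRepA (k : Type*) [Field k] (d n : ℕ) :
    Representation k (Matrix.GeneralLinearGroup (Fin (n + 1)) k) (SegreRing k d n) :=
  Representation.directSum fun m => glRepPiece k d n m

/-- The action of the symmetric group on `A`. -/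
def permRepA (k : Type*) [Field k] (d n : ℕ) :
    Representation k (Equiv.Perm (Fin d)) (SegreRing k d n) :=
  Representation.directSum fun m => permRepPiece k d n m

/-- The two actions on `A` commute. -/
theorem glRepA_permRepA_comm (k : Type*) [Field k] (d n : ℕ)
    (g : Matrix.GeneralLinearGroup (Fin (n + 1)) k) (σ : Equiv.Perm (Fin d)) :
    glRepA k d n g ∘ₗ permRepA k d n σ = permRepA k d n σ ∘ₗ glRepA k d n g := by
  have key : ∀ p : CoordRing k d n, glRep k d n g (permRep k d n σ p) =
      permRep k d n σ (glRep k d n g p) := by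
    intro p
    have h : (glSubst (g : Matrix (Fin (n + 1)) (Fin (n + 1)) k)).comp
          (MvPolynomial.rename (Prod.map σ id)) =
        (MvPolynomial.rename (R := k) (Prod.map σ id)).comp (glSubst (d := d)
          (g : Matrix (Fin (n + 1)) (Fin (n + 1)) k)) := by
      ext1 p
      simp [glSubst]
    exact congrArg (fun f => f p) h
  refine DirectSum.linearMap_ext _ fun m => LinearMap.ext fun x => ?_
  simp only [glRepA, permRepA, Representation.directSum, LinearMap.comp_apply, MonoidHom.coe_mk,
    OneHom.coe_mk, DirectSum.lmap_lof]
  congr 1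
  exact Subtype.ext (key x)

/-! ### The irreducible representations of the symmetric group -/

/-- The row group of a numbering `T` of the cells of `μ`: permutations preserving each row. -/
def rowGroup {μ : YoungDiagram} {d : ℕ} (T : μ.cells ≃ Fin d) : Set (Equiv.Perm (Fin d)) :=
  {σ | ∀ i, (T.symm (σ i)).1.1 = (T.symm i).1.1}

/-- The column group of a numbering `T` of the cells of `μ`: permutations preserving each column. -/
def colGroup {μ : YoungDiagram} {d : ℕ} (T : μ.cells ≃ Fin d) : Set (Equiv.Perm (Fin d)) :=
  {σ | ∀ i, (T.symm (σ i)).1.2 = (T.symm i).1.2}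

open Classical in
/-- The Young symmetrizer `c = a * b`, where `a` is the sum of the row group and `b` is the signed
sum of the column group. -/
def youngSymmetrizer (k : Type*) [Field k] {μ : YoungDiagram} {d : ℕ} (T : μ.cells ≃ Fin d) :
    MonoidAlgebra k (Equiv.Perm (Fin d)) :=
  (∑ σ with σ ∈ rowGroup T, MonoidAlgebra.single σ (1 : k)) *
    ∑ σ with σ ∈ colGroup T, MonoidAlgebra.single σ (((Equiv.Perm.sign σ : ℤˣ) : ℤ) : k)

/-- The underlying space of the irreducible representation `V_μ`: the left ideal of the group
algebra generated by the Young symmetrizer. -/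
def spechtModule (k : Type*) [Field k] {μ : YoungDiagram} {d : ℕ} (T : μ.cells ≃ Fin d) :
    Submodule k (MonoidAlgebra k (Equiv.Perm (Fin d))) :=
  LinearMap.range (LinearMap.mulRight k (youngSymmetrizer k T))

/-- The left regular representation of the symmetric group. -/
def regRep (k : Type*) [Field k] (d : ℕ) :
    Representation k (Equiv.Perm (Fin d)) (MonoidAlgebra k (Equiv.Perm (Fin d))) where
  toFun σ := LinearMap.mulLeft k (MonoidAlgebra.single σ 1)
  map_one' := by
    rw [← MonoidAlgebra.one_def, LinearMap.mulLeft_one]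
    rfl
  map_mul' σ τ := by
    refine LinearMap.ext fun x => ?_
    simp [← mul_assoc, MonoidAlgebra.single_mul_single]

/-- The irreducible representation `V_μ`, by left multiplication. -/
def spechtRep (k : Type*) [Field k] {μ : YoungDiagram} {d : ℕ} (T : μ.cells ≃ Fin d) :
    Representation k (Equiv.Perm (Fin d)) (spechtModule k T) :=
  (regRep k d).subrepresentation (spechtModule k T) fun σ x hx => by
    obtain ⟨y, rfl⟩ := hx
    exact ⟨MonoidAlgebra.single σ 1 * y, by simp [regRep, mul_assoc]⟩

/-! ### The module of covariants -/

/-- `M_μ = Hom_{S_d}(V_μ, A)`. -/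
abbrev CovariantModule (k : Type*) [Field k] (n : ℕ) {μ : YoungDiagram} {d : ℕ}
    (T : μ.cells ≃ Fin d) : Type _ :=
  Representation.IntertwiningMap (spechtRep k T) (permRepA k d n)

/-- The action of `GL(U)` on `M_μ`, by composition with its action on `A`. -/
def covariantRep (k : Type*) [Field k] (n : ℕ) {μ : YoungDiagram} {d : ℕ}
    (T : μ.cells ≃ Fin d) :
    Representation k (Matrix.GeneralLinearGroup (Fin (n + 1)) k) (CovariantModule k n T) where
  toFun g := Representation.IntertwiningMap.llcomp (spechtRep k T) (permRepA k d n) (permRepA k d n)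
    ⟨glRepA k d n g, fun σ => glRepA_permRepA_comm k d n g σ⟩
  map_one' := by
    refine LinearMap.ext fun f => Representation.IntertwiningMap.ext ?_
    refine LinearMap.ext fun v => ?_
    change glRepA k d n 1 (f v) = f v
    simp
  map_mul' g h := by
    refine LinearMap.ext fun f => Representation.IntertwiningMap.ext ?_
    refine LinearMap.ext fun v => ?_
    change glRepA k d n (g * h) (f v) = glRepA k d n g (glRepA k d n h (f v))
    simp

/-- The degree `m` component of `M_μ`: the equivariant maps with values in the degree `m` component
of `A`. -/
def covariantPiece (k : Type*) [Field k] (n : ℕ) {μ : YoungDiagram} {d : ℕ}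
    (T : μ.cells ≃ Fin d) (m : ℕ) : Subrepresentation (covariantRep k n T) where
  toSubmodule :=
    { carrier := {f | ∀ v, f v ∈ LinearMap.range (DirectSum.lof k ℕ (fun m => segrePiece k d n m) m)}
      add_mem' := fun hf hg v => Submodule.add_mem _ (hf v) (hg v)
      zero_mem' := fun _ => Submodule.zero_mem _
      smul_mem' := fun c _ hf v => Submodule.smul_mem _ c (hf v) }
  apply_mem_toSubmodule g f hf v := by
    obtain ⟨x, hx⟩ := hf v
    refine ⟨glRepPiece k d n m g x, ?_⟩
    change _ = glRepA k d n g (f v)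
    rw [← hx]
    simp [glRepA, Representation.directSum]

theorem segrePiece_finite (k : Type*) [Field k] (d n m : ℕ) :
    Module.Finite k (segrePiece k d n m) := by
  have hle : segrePiece k d n m ≤ MvPolynomial.restrictDegree (Fin d × Fin (n + 1)) k m := by
    intro p hp
    rw [MvPolynomial.mem_restrictDegree]
    intro s hs q
    have hw := congrFun (hp (MvPolynomial.mem_support_iff.mp hs)) q.1
    rw [Finsupp.weight_apply, Finsupp.sum, Finset.sum_apply] at hw
    by_cases hq : q ∈ s.support
    · rw [← hw]
      refine le_trans ?_ (Finset.single_le_sum (fun _ _ => Nat.zero_le _) hq)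
      simp [multiWeight]
    · simp [Finsupp.notMem_support_iff.mp hq]
  have : Module.Finite k (MvPolynomial.restrictDegree (Fin d × Fin (n + 1)) k m) := inferInstance
  exact Submodule.finiteDimensional_of_le hle

/-- The components of `M_μ` are finite-dimensional, so that the dimensions below are genuine. -/
theorem covariantPiece_finite (k : Type*) [Field k] (n : ℕ) {μ : YoungDiagram} {d : ℕ}
    (T : μ.cells ≃ Fin d) (m : ℕ) : Module.Finite k (covariantPiece k n T m).toSubmodule := by
  have := segrePiece_finite k d n m
  let F : (covariantPiece k n T m).toSubmodule →ₗ[k] (spechtModule k T →ₗ[k] segrePiece k d n m) :=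
    { toFun := fun f => DirectSum.component k ℕ _ m ∘ₗ f.1.toLinearMap
      map_add' := fun f g => by ext; rfl
      map_smul' := fun c f => by ext; rfl }
  have hF : Function.Injective F := by
    intro f g h
    refine Subtype.ext (Representation.IntertwiningMap.ext (LinearMap.ext fun v => ?_))
    obtain ⟨x, hx⟩ := f.2 v
    obtain ⟨y, hy⟩ := g.2 v
    have h1 := LinearMap.congr_fun h v
    change DirectSum.component k ℕ _ m (f.1 v) = DirectSum.component k ℕ _ m (g.1 v) at h1
    change f.1 v = g.1 v
    rw [← hx, ← hy] at h1 ⊢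
    simp only [DirectSum.component.lof_self] at h1
    rw [h1]
  exact Module.Finite.of_injective F hF

/-! ### Characters and the equivariant Hilbert series for `dim U = 2` -/

/-- The element `diag(t₁, t₂)` of the maximal torus of `GL₂`. -/
def torusElt {k : Type*} [Field k] (t₁ t₂ : kˣ) : Matrix.GeneralLinearGroup (Fin (1 + 1)) k where
  val := Matrix.diagonal ![(t₁ : k), (t₂ : k)]
  inv := Matrix.diagonal ![((t₁⁻¹ : kˣ) : k), ((t₂⁻¹ : kˣ) : k)]
  val_inv := by
    rw [Matrix.diagonal_mul_diagonal, ← Matrix.diagonal_one]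
    congr 1
    funext i
    fin_cases i <;> simp
  inv_val := by
    rw [Matrix.diagonal_mul_diagonal, ← Matrix.diagonal_one]
    congr 1
    funext i
    fin_cases i <;> simp

/-- The weight space `L_{i,j}`: vectors on which `(t₁, t₂)` acts as `t₁^i t₂^j`. -/
def weightSpace {k : Type*} [Field k] {L : Type*} [AddCommMonoid L] [Module k L]
    (ρ : Representation k (Matrix.GeneralLinearGroup (Fin (1 + 1)) k) L) (i j : ℕ) :
    Submodule k L where
  carrier := {v | ∀ t₁ t₂ : kˣ, ρ (torusElt t₁ t₂) v = ((t₁ : k) ^ i * (t₂ : k) ^ j) • v}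
  add_mem' hv hw t₁ t₂ := by rw [map_add, hv t₁ t₂, hw t₁ t₂, smul_add]
  zero_mem' t₁ t₂ := by rw [map_zero, smul_zero]
  smul_mem' c v hv t₁ t₂ := by rw [map_smul, hv t₁ t₂, smul_comm]

/-- The character `∑_{i=0}^e dim(L_{i,e-i}) q^i` of a polynomial representation `L` of `GL₂` of
degree `e`. -/
def character {k : Type*} [Field k] {L : Type*} [AddCommMonoid L] [Module k L] (e : ℕ)
    (ρ : Representation k (Matrix.GeneralLinearGroup (Fin (1 + 1)) k) L) : Polynomial ℤ :=
  ∑ i ∈ Finset.range (e + 1),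
    (Module.finrank k (weightSpace ρ i (e - i)) : Polynomial ℤ) * Polynomial.X ^ i

/-- The equivariant Hilbert series `∑_m ch((M_μ)_m) t^m` in `ℤ[q]⟦t⟧`; here `(M_μ)_m` is a polynomial
representation of degree `d * m`. -/
def equivariantHilbertSeries (k : Type*) [Field k] {μ : YoungDiagram} {d : ℕ}
    (T : μ.cells ≃ Fin d) : PowerSeries (Polynomial ℤ) :=
  PowerSeries.mk fun m =>
    character (L := (covariantPiece k 1 T m).toSubmodule) (d * m)
      (covariantPiece k 1 T m).toRepresentation

/-! ### Tableaux and Schur polynomials -/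

/-- Semistandard tableaux of shape `μ` with entries in `{0, …, N - 1}`. -/
abbrev BoundedSSYT (μ : YoungDiagram) (N : ℕ) : Type :=
  {T : SemistandardYoungTableau μ // ∀ c : μ.cells, T c.1.1 c.1.2 < N}

instance (μ : YoungDiagram) (N : ℕ) : Finite (BoundedSSYT μ N) := by
  refine Finite.of_injective
    (fun (T : BoundedSSYT μ N) (c : μ.cells) => (⟨T.1 c.1.1 c.1.2, T.2 c⟩ : Fin N)) ?_
  intro T T' h
  refine Subtype.ext (SemistandardYoungTableau.ext fun i j => ?_)
  by_cases hc : (i, j) ∈ μ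
  · exact congrArg Fin.val (congrFun h ⟨(i, j), (YoungDiagram.mem_cells (μ := μ) (i, j)).mpr hc⟩)
  · rw [T.1.zeros hc, T'.1.zeros hc]

instance (μ : YoungDiagram) (N : ℕ) : Fintype (BoundedSSYT μ N) := Fintype.ofFinite _

/-- The Schur polynomial `s_μ(x_0, …, x_{N-1}) = ∑_T ∏_c x_{T(c)}`. -/
def schurPolynomial (μ : YoungDiagram) (N : ℕ) : MvPolynomial (Fin N) ℤ :=
  ∑ T : BoundedSSYT μ N, ∏ c : μ.cells, MvPolynomial.X ⟨T.1 c.1.1 c.1.2, T.2 c⟩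

/-- `s_μ(1, q, …, q^m)`. -/
def principalSchur (μ : YoungDiagram) (m : ℕ) : Polynomial ℤ :=
  MvPolynomial.aeval (fun i : Fin (m + 1) => (Polynomial.X : Polynomial ℤ) ^ (i : ℕ))
    (schurPolynomial μ (m + 1))

/-- Standard Young tableaux of shape `μ`: bijective fillings by `1, …, |μ|` that increase along rows
and columns. -/
abbrev StandardTableau (μ : YoungDiagram) : Type :=
  {T : μ.cells ≃ Finset.Icc 1 μ.card //
    (∀ c c' : μ.cells, c.1.1 = c'.1.1 → c.1.2 < c'.1.2 → T c < T c') ∧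
    (∀ c c' : μ.cells, c.1.2 = c'.1.2 → c.1.1 < c'.1.1 → T c < T c')}

instance (μ : YoungDiagram) : Fintype (StandardTableau μ) := Fintype.ofFinite _

open Classical in
/-- The descents of `T`: those `i` for which `i + 1` appears in a lower row than `i`. -/
def descents {μ : YoungDiagram} (T : StandardTableau μ) : Finset ℕ :=
  {i ∈ Finset.Icc 1 μ.card | ∃ c c' : μ.cells,
    (T.1 c : ℕ) = i ∧ (T.1 c' : ℕ) = i + 1 ∧ c.1.1 < c'.1.1}

/-- The number of descents. -/
def des {μ : YoungDiagram} (T : StandardTableau μ) : ℕ := (descents T).card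

/-- The major index: the sum of the descents. -/
def maj {μ : YoungDiagram} (T : StandardTableau μ) : ℕ := ∑ i ∈ descents T, i

end

end Covariants

/-!
Character of `(M_μ)_m`. An equivariant map out of the cyclic module `V_μ = k[S_d] c_μ` is determined
by its value at `c_μ`, which ranges over the image of `c_μ`; hence `(M_μ)_m ≃ c_μ A_m`. In the basis
of monomials, `A_m` is the permutation representation on the fillings of the cells of `μ` with
entries `0, …, m`, and the torus acts on a filling through the sum of its entries. Exactly as for
Specht modules, the elements `c_μ F` with `F` semistandard form a basis of the image of `c_μ` on
every span of a permutation-invariant set of fillings: they span by the Garnir relations, and they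
are independent by triangularity for the pairing of column antisymmetrizations with row
symmetrizations. Counting semistandard fillings with a given sum gives `s_μ(1, q, …, q^m)`.

Generating function. The dimension count does not depend on the order of the entries, which makes
the Schur polynomial symmetric; so each entry `x` may be weighted by `q^(m - x)`. Reading the cells
in the order of its standardization `T`, a semistandard tableau becomes a weakly increasing sequence
of entries that increases strictly at the descents of `T`. It is encoded by its gaps
`l₀, …, l_d ≥ 0`, of sum `m`, with `l_j ≥ 1` at the descents, and its weight is `∏ q^(j l_j)`. So
each gap `l_j` gives a geometric series in `q^j t`, with an extra factor `q^j t` when `j` is a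
descent.
-/

namespace Covariants

noncomputable section

section Rearrangement

variable {ι γ δ α : Type*}

/-- The permutations preserving every fibre of `c`. The row and column groups of a numbered diagram
are the cases where `c` is the row, respectively the column. -/
def fiberPerm (c : ι → γ) : Subgroup (Equiv.Perm ι) where
  carrier := {σ | ∀ z, c (σ z) = c z}
  one_mem' _ := rfl
  mul_mem' hσ hτ z := (hσ _).trans (hτ z)
  inv_mem' {σ} hσ z := by simpa using (hσ (σ⁻¹ z)).symm

theorem swap_mem_fiberPerm [DecidableEq ι] {c : ι → γ} {z z' : ι} (h : c z = c z') :
    Equiv.swap z z' ∈ fiberPerm c := fun w => by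
  rw [Equiv.swap_apply_def]
  split_ifs with hz hz'
  · rw [hz, h]
  · rw [hz', h]
  · rfl

/-- `F` is weakly increasing in `r` along each fibre of `c`. -/
def FiberMonotone [LT δ] [LE α] (c : ι → γ) (r : ι → δ) (F : ι → α) : Prop :=
  ∀ ⦃z z'⦄, c z = c z' → r z < r z' → F z ≤ F z'

/-- `F` is strictly increasing in `r` along each fibre of `c`. -/
def FiberStrictMono [LT δ] [LT α] (c : ι → γ) (r : ι → δ) (F : ι → α) : Prop :=
  ∀ ⦃z z'⦄, c z = c z' → r z < r z' → F z < F z'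

theorem FiberStrictMono.fiberMonotone [LT δ] [Preorder α] {c : ι → γ} {r : ι → δ} {F : ι → α}
    (hF : FiberStrictMono c r F) : FiberMonotone c r F :=
  fun _ _ hc hr => (hF hc hr).le

theorem FiberStrictMono.eq_of_eq [LinearOrder δ] [Preorder α] {c : ι → γ} {r : ι → δ} {F : ι → α}
    (hF : FiberStrictMono c r F) (hcr : Function.Injective fun z => (c z, r z)) {z z' : ι}
    (hc : c z = c z') (h : F z = F z') : z = z' := by
  rcases lt_trichotomy (r z) (r z') with hr | hr | hr
  · exact absurd h (hF hc hr).ne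
  · exact hcr (Prod.ext hc hr)
  · exact absurd h.symm (hF hc.symm hr).ne

/-- Both factors are compared with a constant, namely `t` for `F ∘ σ`: the difference of the two
sums is `∑ w, (c w - c (σ w)) * (F (σ w) - t)`, with nonnegative terms. -/
theorem sum_mul_lt_sum_mul_comp {R : Type*} [Fintype ι] [CommSemiring R] [LinearOrder R]
    [IsStrictOrderedRing R] [ExistsAddOfLE R] {c F : ι → R} {σ : Equiv.Perm ι} {t : R}
    (hσ : σ ∉ fiberPerm c) (hlt : ∀ w, c (σ w) < c w → t < F (σ w))
    (hle : ∀ w, c w < c (σ w) → F (σ w) ≤ t) :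
    ∑ w, c w * F w < ∑ w, c w * F (σ w) := by
  have hterm (w : ι) : c (σ w) * F (σ w) + c w * t ≤ c (σ w) * t + c w * F (σ w) := by
    rcases lt_trichotomy (c (σ w)) (c w) with h | h | h
    · exact (mul_add_mul_lt_mul_add_mul h (hlt w h)).le
    · rw [h, add_comm]
    · exact mul_add_mul_le_mul_add_mul' h.le (hle w h)
  have hσc : ∑ w, c (σ w) = ∑ w, c w := Equiv.sum_comp σ c
  obtain ⟨w, hw⟩ : ∃ w, c (σ w) < c w := by
    by_contra! h
    exact hσ fun w => ((Finset.sum_eq_sum_iff_of_le fun i _ => h i).mp hσc.symm w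
      (Finset.mem_univ w)).symm
  have hsum : ∑ w, (c (σ w) * F (σ w) + c w * t) < ∑ w, (c (σ w) * t + c w * F (σ w)) :=
    Finset.sum_lt_sum (fun w _ => hterm w)
      ⟨w, Finset.mem_univ w, mul_add_mul_lt_mul_add_mul hw (hlt w hw)⟩
  rw [Finset.sum_add_distrib, Finset.sum_add_distrib, ← Finset.sum_mul, ← Finset.sum_mul, hσc,
    Equiv.sum_comp σ fun w => c w * F w, add_comm] at hsum
  exact lt_of_add_lt_add_left hsum

theorem FiberMonotone.le_comp [Finite ι] [LinearOrder δ] [LinearOrder α] {c : ι → γ} {r : ι → δ}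
    {F : ι → α} {σ : Equiv.Perm ι} (hcr : Function.Injective fun z => (c z, r z))
    (hσ : σ ∈ fiberPerm c) (hF : FiberMonotone c r F) (hFσ : FiberMonotone c r (F ∘ σ)) (z : ι) :
    F z ≤ F (σ z) := by
  by_contra! hz
  -- Otherwise `σ` would inject the cells up to `z` of the fibre into those strictly before `z`.
  have hmaps (w : ι) (hw : c w = c z ∧ r w ≤ r z) : c (σ w) = c z ∧ r (σ w) < r z := by
    have hc : c (σ w) = c z := (hσ w).trans hw.1
    have hlt : F (σ w) < F z := by
      rcases hw.2.lt_or_eq with hr | hr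
      · exact (hFσ hw.1 hr).trans_lt hz
      · rwa [hcr (Prod.ext hw.1 hr)]
    refine ⟨hc, lt_of_not_ge fun hr => ?_⟩
    rcases hr.lt_or_eq with hr | hr
    · exact hlt.not_ge (hF hc.symm hr)
    · exact hlt.ne (congrArg F (hcr (Prod.ext hc hr.symm)))
  have hsub : σ '' {w | c w = c z ∧ r w ≤ r z} ⊆ {w | c w = c z ∧ r w ≤ r z} := by
    rintro _ ⟨w, hw, rfl⟩
    exact ⟨(hmaps w hw).1, (hmaps w hw).2.le⟩
  have himage := Set.eq_of_subset_of_ncard_le hsub (Set.ncard_image_of_injective _ σ.injective).ge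
  obtain ⟨w, hw, hwz⟩ : z ∈ σ '' {w | c w = c z ∧ r w ≤ r z} := by
    rw [himage]; exact ⟨rfl, le_rfl⟩
  exact (hmaps w hw).2.ne (congrArg r hwz)

theorem FiberMonotone.comp_eq [Finite ι] [LinearOrder δ] [LinearOrder α] {c : ι → γ} {r : ι → δ}
    {F : ι → α} {σ : Equiv.Perm ι} (hcr : Function.Injective fun z => (c z, r z))
    (hσ : σ ∈ fiberPerm c) (hF : FiberMonotone c r F) (hFσ : FiberMonotone c r (F ∘ σ)) :
    F ∘ σ = F := by
  funext z
  refine le_antisymm ?_ (hF.le_comp hcr hσ hFσ z)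
  have hinv : (F ∘ σ) ∘ ⇑σ⁻¹ = F := by funext w; simp
  simpa using hFσ.le_comp hcr (inv_mem hσ) (by rwa [hinv]) z

section Sorting

variable [Fintype ι] [CommSemiring α] [LinearOrder α] [IsStrictOrderedRing α] [ExistsAddOfLE α]

theorem fiberMonotone_comp_of_isMax {c : ι → γ} {r F : ι → α} {τ : Equiv.Perm ι}
    (hτ : τ ∈ fiberPerm c)
    (hmax : ∀ σ ∈ fiberPerm c, ∑ z, r z * F (σ z) ≤ ∑ z, r z * F (τ z)) :
    FiberMonotone c r (F ∘ τ) := by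
  classical
  intro z z' hc hr
  by_contra! hlt
  have hswap (w : ι) (hw : r (Equiv.swap z z' w) ≠ r w) : w = z ∨ w = z' := by
    by_contra! h
    exact hw (by rw [Equiv.swap_apply_of_ne_of_ne h.1 h.2])
  refine (hmax _ (mul_mem hτ (swap_mem_fiberPerm hc))).not_gt
    (sum_mul_lt_sum_mul_comp (F := F ∘ τ) (t := F (τ z')) ?_ (fun w hw => ?_) fun w hw => ?_)
  · exact fun h => hr.ne' (by simpa using h z)
  · obtain rfl | rfl := hswap w hw.ne
    · exact absurd hw (by simpa using hr.le)
    · simpa using hlt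
  · obtain rfl | rfl := hswap w hw.ne'
    · simp
    · exact absurd hw (by simpa using hr.le)

theorem FiberStrictMono.sum_mul_comp_lt {c : ι → γ} {r F : ι → α}
    (hcr : Function.Injective fun z => (c z, r z)) (hF : FiberStrictMono c r F)
    {σ : Equiv.Perm ι} (hσ : σ ∈ fiberPerm c) (hσ1 : σ ≠ 1) :
    ∑ z, r z * F (σ z) < ∑ z, r z * F z := by
  have eq_one_of_isMax (τ) (hτ : τ ∈ fiberPerm c)
      (hmax : ∀ σ ∈ fiberPerm c, ∑ z, r z * F (σ z) ≤ ∑ z, r z * F (τ z)) : τ = 1 :=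
    Equiv.ext fun z => hF.eq_of_eq hcr (hτ z)
      (congrFun (hF.fiberMonotone.comp_eq hcr hτ (fiberMonotone_comp_of_isMax hτ hmax)) z)
  obtain ⟨τ, hτ, hmax⟩ := Set.exists_max_image (fiberPerm c : Set (Equiv.Perm ι))
    (fun τ => ∑ z, r z * F (τ z)) (Set.toFinite _) ⟨1, one_mem _⟩
  obtain rfl := eq_one_of_isMax τ hτ hmax
  exact lt_of_not_ge fun h => hσ1 (eq_one_of_isMax σ hσ fun ρ hρ => (hmax ρ hρ).trans h)

end Sorting

theorem exists_fiberMonotone_comp [Finite ι] [CommSemiring α] [LinearOrder α]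
    [IsStrictOrderedRing α] [ExistsAddOfLE α] (c : ι → γ) (r F : ι → α) :
    ∃ τ ∈ fiberPerm c, FiberMonotone c r (F ∘ τ) := by
  have := Fintype.ofFinite ι
  obtain ⟨τ, hτ, hmax⟩ := Set.exists_max_image (fiberPerm c : Set (Equiv.Perm ι))
    (fun τ => ∑ z, r z * F (τ z)) (Set.toFinite _) ⟨1, one_mem _⟩
  exact ⟨τ, hτ, fiberMonotone_comp_of_isMax hτ hmax⟩

end Rearrangement

section GroupAlgebra

variable {R k G : Type*} [Group G]

/-- The sum in the group algebra of the elements of a subgroup `H`, weighted by a character `χ`. -/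
def charSum [CommSemiring R] (χ : G →* R) (H : Subgroup G) [Fintype H] : MonoidAlgebra R G :=
  ∑ h : H, MonoidAlgebra.single (h : G) (χ h)

theorem charSum_mul_single [CommSemiring R] (χ : G →* R) {H : Subgroup G} [Fintype H] {h : G}
    (hh : h ∈ H) : charSum χ H * MonoidAlgebra.single h (χ h) = charSum χ H := by
  simp only [charSum, Finset.sum_mul, MonoidAlgebra.single_mul_single, ← map_mul]
  exact Equiv.sum_comp (Equiv.mulRight (⟨h, hh⟩ : H)) fun g => MonoidAlgebra.single (g : G) (χ g)

theorem single_mul_charSum [CommSemiring R] (χ : G →* R) {H : Subgroup G} [Fintype H] {h : G}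
    (hh : h ∈ H) : MonoidAlgebra.single h (χ h) * charSum χ H = charSum χ H := by
  simp only [charSum, Finset.mul_sum, MonoidAlgebra.single_mul_single, ← map_mul]
  exact Equiv.sum_comp (Equiv.mulLeft (⟨h, hh⟩ : H)) fun g => MonoidAlgebra.single (g : G) (χ g)

theorem charSum_mul_single_mul_charSum_eq_zero [Field k] {χ ψ : G →* k} {H K : Subgroup G}
    [Fintype H] [Fintype K] {g h h' : G} (hh : h ∈ H) (hh' : h' ∈ K) (hconj : h * g = g * h')
    (hne : χ h ≠ ψ h') (a : k) :
    charSum χ H * MonoidAlgebra.single g a * charSum ψ K = 0 := by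
  set x := charSum χ H * MonoidAlgebra.single g a * charSum ψ K with hx
  have key : ψ h' • x = χ h • x :=
    calc ψ h' • x
        = charSum χ H * MonoidAlgebra.single (h * g) (χ h * a * ψ h') * charSum ψ K := by
          rw [hx, mul_assoc (χ h), ← MonoidAlgebra.single_mul_single, ← mul_assoc,
            charSum_mul_single χ hh, mul_comm a, ← smul_eq_mul (ψ h') a,
            ← MonoidAlgebra.smul_single, mul_smul_comm, smul_mul_assoc]
      _ = χ h • x := by
          rw [hx, hconj, ← MonoidAlgebra.single_mul_single, mul_assoc, mul_assoc,
            single_mul_charSum ψ hh', ← smul_eq_mul (χ h) a, ← MonoidAlgebra.smul_single,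
            smul_mul_assoc, mul_smul_comm, mul_assoc]
  have hzero : (χ h - ψ h') • x = 0 := by rw [sub_smul, key, sub_self]
  exact (smul_eq_zero.mp hzero).resolve_left (sub_ne_zero.mpr hne)

theorem exists_mul_mul_eq_self [Ring R] [IsSemisimpleRing R] (c : R) : ∃ y, c * y * c = c := by
  obtain ⟨q, hq⟩ := exists_isCompl (R ∙ c)
  obtain ⟨_, he, f, hf, hef⟩ :=
    Submodule.mem_sup.mp (hq.sup_eq_top ▸ Submodule.mem_top (x := (1 : R)))
  obtain ⟨y, rfl⟩ := Submodule.mem_span_singleton.mp he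
  have hcf : c * f = c - c * y * c := by
    rw [eq_sub_of_add_eq' hef, smul_eq_mul, mul_sub, mul_one, mul_assoc]
  have hspan : c - c * y * c ∈ R ∙ c :=
    Submodule.mem_span_singleton.mpr ⟨1 - c * y, by rw [smul_eq_mul, sub_mul, one_mul]⟩
  exact ⟨y, (sub_eq_zero.mp
    (Submodule.disjoint_def.mp hq.disjoint _ hspan (hcf ▸ q.smul_mem c hf))).symm⟩

end GroupAlgebra

section Numbering

variable {μ : YoungDiagram} {d : ℕ} (T : μ.cells ≃ Fin d)

/-- The row of the cell carrying a given number. -/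
def cellRow (z : Fin d) : ℕ := (T.symm z).1.1

/-- The column of the cell carrying a given number. -/
def cellCol (z : Fin d) : ℕ := (T.symm z).1.2

theorem cell_mem (z : Fin d) : (cellRow T z, cellCol T z) ∈ μ :=
  (YoungDiagram.mem_cells _).mp (T.symm z).2

theorem cell_injective : Function.Injective fun z => (cellRow T z, cellCol T z) :=
  fun _ _ h => T.symm.injective (Subtype.ext h)

theorem cell_swap_injective : Function.Injective fun z => (cellCol T z, cellRow T z) :=
  Prod.swap_injective.comp (cell_injective T)

theorem exists_cell {i j : ℕ} (h : (i, j) ∈ μ) : ∃ z, cellRow T z = i ∧ cellCol T z = j :=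
  ⟨T ⟨(i, j), (YoungDiagram.mem_cells _).mpr h⟩, by simp [cellRow], by simp [cellCol]⟩

/-- The filling `F` of the cells numbered by `T` is semistandard. -/
def IsSemistandard (F : Fin d → ℕ) : Prop :=
  FiberMonotone (cellRow T) (cellCol T) F ∧ FiberStrictMono (cellCol T) (cellRow T) F

/-- The sign character of the symmetric group, with values in `k`. -/
def signHom (k ι : Type*) [Ring k] [Fintype ι] [DecidableEq ι] : Equiv.Perm ι →* k :=
  (Int.castRingHom k : ℤ →* k).comp ((Units.coeHom ℤ).comp Equiv.Perm.sign)

theorem signHom_swap {k ι : Type*} [Ring k] [Fintype ι] [DecidableEq ι] {z z' : ι} (h : z ≠ z') :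
    signHom k ι (Equiv.swap z z') = -1 := by
  simp [signHom, Equiv.Perm.sign_swap h]

theorem signHom_inv {k ι : Type*} [Ring k] [Fintype ι] [DecidableEq ι] (σ : Equiv.Perm ι) :
    signHom k ι σ⁻¹ = signHom k ι σ := by
  simp [signHom]

instance {ι γ : Type*} [Finite ι] (c : ι → γ) : Fintype (fiberPerm c) := Fintype.ofFinite _

theorem youngSymmetrizer_eq (k : Type*) [Field k] :
    youngSymmetrizer k T =
      charSum 1 (fiberPerm (cellRow T)) * charSum (signHom k (Fin d)) (fiberPerm (cellCol T)) := by
  classical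
  rw [youngSymmetrizer, charSum, charSum]
  congr 1
  · exact Finset.sum_subtype _ (fun σ => Finset.mem_filter_univ σ) _
  · exact Finset.sum_subtype _ (fun σ => Finset.mem_filter_univ σ) _

theorem youngSymmetrizer_mul_single (k : Type*) [Field k] {τ : Equiv.Perm (Fin d)}
    (hτ : τ ∈ fiberPerm (cellCol T)) :
    youngSymmetrizer k T * MonoidAlgebra.single τ (signHom k (Fin d) τ) = youngSymmetrizer k T := by
  rw [youngSymmetrizer_eq, mul_assoc, charSum_mul_single _ hτ]

/-- If every column permutation moves two points `z`, `z'` exchanged by `K` into a common row, then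
each `τ` of the column group intertwines a row transposition, of character `1`, with a transposition
of `K`, of sign `-1`. -/
theorem youngSymmetrizer_mul_charSum_eq_zero (k : Type*) [Field k] [CharZero k]
    {K : Subgroup (Equiv.Perm (Fin d))} [Fintype K]
    (hK : ∀ τ ∈ fiberPerm (cellCol T), ∃ z z', z ≠ z' ∧ Equiv.swap z z' ∈ K ∧
      cellRow T (τ z) = cellRow T (τ z')) :
    youngSymmetrizer k T * charSum (signHom k (Fin d)) K = 0 := by
  rw [youngSymmetrizer_eq, charSum.eq_1 (signHom k (Fin d)) (fiberPerm _), Finset.mul_sum,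
    Finset.sum_mul]
  refine Finset.sum_eq_zero fun τ _ => ?_
  obtain ⟨z, z', hne, hswap, hrow⟩ := hK τ τ.2
  refine charSum_mul_single_mul_charSum_eq_zero (swap_mem_fiberPerm hrow) hswap
    (Equiv.mul_swap_eq_swap_mul _ _ _).symm ?_ _
  rw [MonoidHom.one_apply, signHom_swap hne]
  exact (neg_ne_self.mpr one_ne_zero).symm

end Numbering

section Fillings

/-- The permutation representation on the span of all fillings `ι → α`, where `σ` sends `F` to
`F ∘ σ⁻¹`. -/
def fillingRep (k ι α : Type*) [Field k] : Representation k (Equiv.Perm ι) ((ι → α) →₀ k) where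
  toFun σ := Finsupp.lmapDomain k k fun F => F ∘ ⇑σ⁻¹
  map_one' := by ext F : 2; simp
  map_mul' σ τ := by ext F : 2; simp; rfl

theorem fillingRep_single {k ι α : Type*} [Field k] (σ : Equiv.Perm ι) (F : ι → α) (a : k) :
    fillingRep k ι α σ (Finsupp.single F a) = Finsupp.single (F ∘ ⇑σ⁻¹) a := by
  simp [fillingRep]

variable {μ : YoungDiagram} {d : ℕ} {k α : Type*} [Field k] (T : μ.cells ≃ Fin d)

/-- The Young symmetrizer applied to a filling. -/
def symmVec (k : Type*) [Field k] (F : Fin d → α) : (Fin d → α) →₀ k :=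
  (fillingRep k (Fin d) α).asAlgebraHom (youngSymmetrizer k T) (Finsupp.single F 1)

theorem asAlgebraHom_mul_single (x : MonoidAlgebra k (Equiv.Perm (Fin d)))
    (σ : Equiv.Perm (Fin d)) (a : k) (F : Fin d → α) :
    (fillingRep k (Fin d) α).asAlgebraHom (x * MonoidAlgebra.single σ a) (Finsupp.single F 1) =
      a • (fillingRep k (Fin d) α).asAlgebraHom x (Finsupp.single (F ∘ ⇑σ⁻¹) 1) := by
  rw [map_mul, Module.End.mul_apply, Representation.asAlgebraHom_single, LinearMap.smul_apply,
    fillingRep_single, map_smul]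

theorem symmVec_comp {τ : Equiv.Perm (Fin d)} (hτ : τ ∈ fiberPerm (cellCol T)) (F : Fin d → α) :
    signHom k (Fin d) τ • symmVec T k (F ∘ τ) = symmVec T k F := by
  have h := asAlgebraHom_mul_single (youngSymmetrizer k T) τ⁻¹ (signHom k (Fin d) τ⁻¹) F
  rw [youngSymmetrizer_mul_single T k (inv_mem hτ), inv_inv, signHom_inv] at h
  exact h.symm

theorem symmVec_eq_zero [CharZero k] {F : Fin d → α} {z z' : Fin d} (hne : z ≠ z')
    (hcol : cellCol T z = cellCol T z') (hF : F z = F z') : symmVec T k F = 0 := by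
  have hswap : F ∘ Equiv.swap z z' = F := by
    funext w
    exact swap_mem_fiberPerm hF w
  have h := symmVec_comp (k := k) T (swap_mem_fiberPerm hcol) F
  rw [hswap, signHom_swap hne, neg_one_smul] at h
  exact neg_eq_self.mp h

theorem sum_sign_smul_symmVec_eq_zero [CharZero k] {K : Subgroup (Equiv.Perm (Fin d))} [Fintype K]
    (hK : ∀ τ ∈ fiberPerm (cellCol T), ∃ z z', z ≠ z' ∧ Equiv.swap z z' ∈ K ∧
      cellRow T (τ z) = cellRow T (τ z')) (F : Fin d → α) :
    ∑ σ : K, signHom k (Fin d) σ • symmVec T k (F ∘ (σ : Equiv.Perm (Fin d))) = 0 := by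
  have h := congrArg (fun x => (fillingRep k (Fin d) α).asAlgebraHom x (Finsupp.single F 1))
    (youngSymmetrizer_mul_charSum_eq_zero T k hK)
  simp only [charSum, Finset.mul_sum, map_sum, LinearMap.sum_apply, asAlgebraHom_mul_single,
    map_zero, LinearMap.zero_apply] at h
  rw [← h, ← Equiv.sum_comp (Equiv.inv K)]
  simp [symmVec, signHom_inv]

end Fillings

section Garnir

variable {μ : YoungDiagram} {d : ℕ} (T : μ.cells ≃ Fin d)

/-- The cells of a Garnir relation for two cells `z₀`, `z₁` of a common row: those weakly below `z₀`
in its column, and those weakly above `z₁` in its column. -/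
def garnirSet (z₀ z₁ : Fin d) : Set (Fin d) :=
  {z | (cellCol T z = cellCol T z₀ ∧ cellRow T z₀ ≤ cellRow T z) ∨
    (cellCol T z = cellCol T z₁ ∧ cellRow T z ≤ cellRow T z₀)}

/-- The Garnir set has one cell more than the column of `z₀` has rows. -/
theorem exists_ne_mem_garnirSet_row_eq {z₀ z₁ : Fin d} (hrow : cellRow T z₀ = cellRow T z₁)
    (hcol : cellCol T z₀ < cellCol T z₁) {τ : Equiv.Perm (Fin d)}
    (hτ : τ ∈ fiberPerm (cellCol T)) :
    ∃ z ∈ garnirSet T z₀ z₁, ∃ z' ∈ garnirSet T z₀ z₁,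
      z ≠ z' ∧ cellRow T (τ z) = cellRow T (τ z') := by
  set L := μ.colLen (cellCol T z₀)
  have hcell (r : ℕ) (hr : r < L + 1) : ∃ z ∈ garnirSet T z₀ z₁,
      r ≤ cellRow T z₀ ∧ cellRow T z = r ∧ cellCol T z = cellCol T z₁ ∨
        cellRow T z₀ < r ∧ cellRow T z + 1 = r ∧ cellCol T z = cellCol T z₀ := by
    rcases le_or_gt r (cellRow T z₀) with h | h
    · obtain ⟨z, hzr, hzc⟩ := exists_cell T
        (μ.up_left_mem (i1 := r) (h.trans_eq hrow) le_rfl (cell_mem T z₁))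
      exact ⟨z, .inr ⟨hzc, hzr ▸ h⟩, .inl ⟨h, hzr, hzc⟩⟩
    · obtain ⟨z, hzr, hzc⟩ := exists_cell T
        (YoungDiagram.mem_iff_lt_colLen.mpr (show r - 1 < L by lia))
      exact ⟨z, .inl ⟨hzc, by lia⟩, .inr ⟨h, by lia, hzc⟩⟩
  have : Nonempty (Fin d) := ⟨z₀⟩
  choose! cell hmem hcell using hcell
  have hmaps (r : ℕ) (hr : r ∈ Finset.range (L + 1)) :
      cellRow T (τ (cell r)) ∈ Finset.range L := by
    rw [Finset.mem_range] at hr ⊢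
    refine YoungDiagram.mem_iff_lt_colLen.mp (μ.up_left_mem le_rfl ?_ (cell_mem T (τ (cell r))))
    rw [hτ (cell r)]
    rcases hmem r hr with h | h <;> lia
  obtain ⟨r, hr, r', hr', hne, heq⟩ :=
    Finset.exists_ne_map_eq_of_card_lt_of_maps_to (by simp) hmaps
  rw [Finset.mem_range] at hr hr'
  refine ⟨cell r, hmem r hr, cell r', hmem r' hr', fun h => hne ?_, heq⟩
  rcases hcell r hr with h₁ | h₁ <;> rcases hcell r' hr' with h₂ | h₂ <;> rw [h] at h₁ <;> lia

theorem sum_cellCol_mul_lt_of_mem_fixingSubgroup_garnirSet {F : Fin d → ℕ}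
    (hF : FiberStrictMono (cellCol T) (cellRow T) F) {z₀ z₁ : Fin d}
    (hrow : cellRow T z₀ = cellRow T z₁) (hcol : cellCol T z₀ < cellCol T z₁) (hz : F z₁ < F z₀)
    {σ : Equiv.Perm (Fin d)} (hσ : σ ∈ fixingSubgroup (Equiv.Perm (Fin d)) (garnirSet T z₀ z₁)ᶜ)
    (hσcol : σ ∉ fiberPerm (cellCol T)) :
    ∑ z, cellCol T z * F z < ∑ z, cellCol T z * F (σ z) := by
  rw [mem_fixingSubgroup_iff] at hσ
  have hmem (w : Fin d) (hw : cellCol T (σ w) ≠ cellCol T w) :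
      w ∈ garnirSet T z₀ z₁ ∧ σ w ∈ garnirSet T z₀ z₁ := by
    refine ⟨by_contra fun h => hw (congrArg _ (hσ w h)), by_contra fun h => hw ?_⟩
    rw [σ.injective (hσ (σ w) h)]
  have hbelow {z : Fin d} (hc : cellCol T z = cellCol T z₀) (hr : cellRow T z₀ ≤ cellRow T z) :
      F z₀ ≤ F z := by
    rcases hr.eq_or_lt with h | h
    · rw [cell_injective T (Prod.ext h hc.symm)]
    · exact (hF hc.symm h).le
  have habove {z : Fin d} (hc : cellCol T z = cellCol T z₁) (hr : cellRow T z ≤ cellRow T z₀) :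
      F z ≤ F z₁ := by
    rcases (hr.trans_eq hrow).eq_or_lt with h | h
    · rw [cell_injective T (Prod.ext h hc)]
    · exact (hF hc h).le
  refine sum_mul_lt_sum_mul_comp (t := F z₁) hσcol (fun w hw => ?_) fun w hw => ?_
  · obtain ⟨h | h, h' | h'⟩ := hmem w hw.ne
    · lia
    · lia
    · exact hz.trans_le (hbelow h'.1 h'.2)
    · lia
  · obtain ⟨h | h, h' | h'⟩ := hmem w hw.ne'
    · lia
    · exact habove h'.1 h'.2
    · lia
    · lia

end Garnir

section Straightening

variable {μ : YoungDiagram} {d : ℕ} {k α : Type*} [Field k] [CharZero k] (T : μ.cells ≃ Fin d)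
  (e : α ↪ ℕ)

/-- The identity of the group algebra behind this is the Garnir relation: its terms in the column
group are all equal to `symmVec T k F`, and the others are further up in the order. -/
theorem symmVec_mem_of_forall_lt {F : Fin d → α}
    (hF : FiberStrictMono (cellCol T) (cellRow T) (e ∘ F)) {z₀ z₁ : Fin d}
    (hrow : cellRow T z₀ = cellRow T z₁) (hcol : cellCol T z₀ < cellCol T z₁)
    (hz : e (F z₁) < e (F z₀)) {Q : Submodule k ((Fin d → α) →₀ k)}
    (hQ : ∀ σ : Equiv.Perm (Fin d),
      ∑ z, cellCol T z * e (F z) < ∑ z, cellCol T z * e (F (σ z)) → symmVec T k (F ∘ σ) ∈ Q) :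
    symmVec T k F ∈ Q := by
  classical
  let K := fixingSubgroup (Equiv.Perm (Fin d)) (garnirSet T z₀ z₁)ᶜ
  let term (σ : K) := signHom k (Fin d) σ • symmVec T k (F ∘ (σ : Equiv.Perm (Fin d)))
  have hgarnir : ∑ σ, term σ = 0 := by
    refine sum_sign_smul_symmVec_eq_zero T (fun τ hτ => ?_) F
    obtain ⟨z, hz, z', hz', hne, hrow'⟩ := exists_ne_mem_garnirSet_row_eq T hrow hcol hτ
    refine ⟨z, z', hne, mem_fixingSubgroup_iff _ |>.mpr fun w hw => ?_, hrow'⟩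
    exact Equiv.swap_apply_of_ne_of_ne (by rintro rfl; exact hw hz) (by rintro rfl; exact hw hz')
  let S : Finset K := {σ | (σ : Equiv.Perm (Fin d)) ∈ fiberPerm (cellCol T)}
  have hequal : ∑ σ ∈ S, term σ = (S.card : k) • symmVec T k F := by
    rw [Nat.cast_smul_eq_nsmul, ← Finset.sum_const]
    exact Finset.sum_congr rfl fun σ hσ => symmVec_comp T (Finset.mem_filter.mp hσ).2 F
  have hhigher : ∑ σ ∈ Sᶜ, term σ ∈ Q := by
    refine Q.sum_mem fun σ hσ => Q.smul_mem _ (hQ σ ?_)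
    exact sum_cellCol_mul_lt_of_mem_fixingSubgroup_garnirSet T hF hrow hcol hz σ.2
      (by simpa [S] using hσ)
  have hcard : (S.card : k) ≠ 0 :=
    Nat.cast_ne_zero.mpr (Finset.card_ne_zero_of_mem (a := 1) (by simp [S, one_mem]))
  rw [← Finset.sum_add_sum_compl S, hequal] at hgarnir
  rw [← Submodule.smul_mem_iff Q hcard, eq_neg_of_add_eq_zero_left hgarnir]
  exact Q.neg_mem hhigher

theorem symmVec_mem_span {P : Set (Fin d → α)}
    (hP : ∀ F ∈ P, ∀ σ : Equiv.Perm (Fin d), F ∘ σ ∈ P) {F : Fin d → α} (hF : F ∈ P) :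
    symmVec T k F ∈ Submodule.span k (symmVec T k '' {G ∈ P | IsSemistandard T (e ∘ G)}) := by
  set Q := Submodule.span k (symmVec T k '' {G ∈ P | IsSemistandard T (e ∘ G)})
  suffices h : ∀ σ : Equiv.Perm (Fin d), symmVec T k (F ∘ σ) ∈ Q from h 1
  by_contra! hne
  -- A column sorted rearrangement outside `Q` which is highest in the order contradicts
  -- straightening.
  obtain ⟨σ, hσ, hmax⟩ := Set.exists_max_image {σ : Equiv.Perm (Fin d) | symmVec T k (F ∘ σ) ∉ Q}
    (fun σ => ∑ z, cellCol T z * e (F (σ z))) (Set.toFinite _) hne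
  obtain ⟨τ, hτ, hsorted⟩ :=
    exists_fiberMonotone_comp (cellCol T) (cellRow T) (fun z => e (F (σ z)))
  have hweight : ∑ z, cellCol T z * e (F (σ (τ z))) = ∑ z, cellCol T z * e (F (σ z)) := by
    rw [← Equiv.sum_comp τ fun z => cellCol T z * e (F (σ z))]
    exact Finset.sum_congr rfl fun z _ => by rw [hτ z]
  have hστ : symmVec T k (F ∘ σ ∘ τ) ∉ Q := fun h =>
    hσ (symmVec_comp (k := k) T hτ (F ∘ σ) ▸ Q.smul_mem _ h)
  have hstrict : FiberStrictMono (cellCol T) (cellRow T) (e ∘ F ∘ σ ∘ τ) := by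
    intro z z' hc hr
    refine (hsorted hc hr).lt_of_ne fun heq => hστ ?_
    rw [symmVec_eq_zero T (by rintro rfl; exact hr.false) hc (e.injective heq)]
    exact Q.zero_mem
  refine hστ ?_
  by_cases hrows : FiberMonotone (cellRow T) (cellCol T) (e ∘ F ∘ σ ∘ τ)
  · exact Submodule.subset_span ⟨_, ⟨hP F hF (σ * τ), hrows, hstrict⟩, rfl⟩
  · simp only [FiberMonotone, not_forall, not_le] at hrows
    obtain ⟨z₀, z₁, hrow, hcol, hz⟩ := hrows
    refine symmVec_mem_of_forall_lt T e hstrict hrow hcol hz fun ρ hρ => ?_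
    by_contra hmem
    exact (hmax (σ * τ * ρ) hmem).not_gt (hweight.symm.trans_lt hρ)

end Straightening

section Independence

theorem linearIndependent_of_triangular {κ ι β k : Type*} [Field k] [LinearOrder β]
    {v : κ → ι →₀ k} (p : κ → ι) (w : κ → β) (hdiag : ∀ a, v a (p a) ≠ 0)
    (hlt : ∀ a b, a ≠ b → v b (p a) ≠ 0 → w a < w b) : LinearIndependent k v := by
  classical
  rw [linearIndependent_iff']
  intro s g hg
  by_contra! hne
  obtain ⟨a, ha, hmax⟩ := (s.filter (g · ≠ 0)).exists_max_image w
    (hne.imp fun a ha => Finset.mem_filter.mpr ha)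
  obtain ⟨has, hga⟩ := Finset.mem_filter.mp ha
  have hcoeff := DFunLike.congr_fun hg (p a)
  rw [Finsupp.finsetSum_apply, Finset.sum_eq_single_of_mem a has fun b hb hba => ?_] at hcoeff
  · exact mul_ne_zero hga (hdiag a) hcoeff
  · by_contra h
    obtain ⟨hgb, hvb⟩ := mul_ne_zero_iff.mp h
    exact (hlt a b hba.symm hvb).not_ge (hmax b (Finset.mem_filter.mpr ⟨hb, hgb⟩))

variable {μ : YoungDiagram} {d : ℕ} {k α : Type*} [Field k] (T : μ.cells ≃ Fin d)

theorem symmVec_eq_sum (F : Fin d → α) :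
    symmVec T k F = ∑ ρ : fiberPerm (cellRow T), ∑ τ : fiberPerm (cellCol T),
      Finsupp.single (F ∘ (τ : Equiv.Perm (Fin d)) ∘ (ρ : Equiv.Perm (Fin d)))
        (signHom k (Fin d) τ) := by
  rw [symmVec, youngSymmetrizer_eq, charSum, charSum, Finset.sum_mul,
    ← Equiv.sum_comp (Equiv.inv (fiberPerm (cellRow T)))]
  simp only [Finset.mul_sum, MonoidAlgebra.single_mul_single, map_sum, LinearMap.sum_apply,
    Representation.asAlgebraHom_single, LinearMap.smul_apply, fillingRep_single]
  refine Finset.sum_congr rfl fun ρ _ => ?_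
  rw [← Equiv.sum_comp (Equiv.inv (fiberPerm (cellCol T)))]
  refine Finset.sum_congr rfl fun τ _ => ?_
  simp [signHom_inv]

theorem sum_cellRow_mul_lt {F : Fin d → ℕ} (hF : FiberStrictMono (cellCol T) (cellRow T) F)
    {ρ τ : Equiv.Perm (Fin d)} (hρ : ρ ∈ fiberPerm (cellRow T)) (hτ : τ ∈ fiberPerm (cellCol T))
    (hτ1 : τ ≠ 1) : ∑ z, cellRow T z * F (τ (ρ z)) < ∑ z, cellRow T z * F z := by
  have hrow : ∑ z, cellRow T z * F (τ (ρ z)) = ∑ z, cellRow T z * F (τ z) := by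
    rw [← Equiv.sum_comp ρ fun z => cellRow T z * F (τ z)]
    exact Finset.sum_congr rfl fun z _ => by rw [hρ z]
  exact hrow.trans_lt (hF.sum_mul_comp_lt (cell_swap_injective T) hτ hτ1)

variable (e : α ↪ ℕ)

theorem symmVec_apply_self_ne_zero [CharZero k] {F : Fin d → α}
    (hF : IsSemistandard T (e ∘ F)) : symmVec T k F F ≠ 0 := by
  classical
  have hone (ρ : fiberPerm (cellRow T)) (τ : fiberPerm (cellCol T)) (hτ : τ ≠ 1) :
      F ∘ (τ : Equiv.Perm (Fin d)) ∘ (ρ : Equiv.Perm (Fin d)) ≠ F := fun h =>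
    (sum_cellRow_mul_lt T hF.2 ρ.2 τ.2 (by simpa using hτ)).ne
      (by simpa using congrArg (fun G => ∑ z, cellRow T z * e (G z)) h)
  have hcoeff : symmVec T k F F =
      ((Finset.univ.filter fun ρ : fiberPerm (cellRow T) =>
        F ∘ (ρ : Equiv.Perm (Fin d)) = F).card : k) := by
    rw [symmVec_eq_sum, Finsupp.finsetSum_apply, Finset.card_filter, Nat.cast_sum]
    refine Finset.sum_congr rfl fun ρ _ => ?_
    rw [Finsupp.finsetSum_apply, Finset.sum_eq_single 1 (fun τ _ hτ => ?_) (by simp)]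
    · simp [Finsupp.single_apply]
    · exact Finsupp.single_eq_of_ne' (hone ρ τ hτ)
  rw [hcoeff, Nat.cast_ne_zero]
  exact Finset.card_ne_zero_of_mem (a := 1) (by simp)

theorem sum_cellRow_mul_lt_of_symmVec_apply_ne_zero {F G : Fin d → α}
    (hF : IsSemistandard T (e ∘ F)) (hG : IsSemistandard T (e ∘ G)) (hGF : G ≠ F)
    (h : symmVec T k F G ≠ 0) :
    ∑ z, cellRow T z * e (G z) < ∑ z, cellRow T z * e (F z) := by
  classical
  rw [symmVec_eq_sum, Finsupp.finsetSum_apply] at h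
  obtain ⟨ρ, -, h⟩ := Finset.exists_ne_zero_of_sum_ne_zero h
  rw [Finsupp.finsetSum_apply] at h
  obtain ⟨τ, -, h⟩ := Finset.exists_ne_zero_of_sum_ne_zero h
  obtain rfl : F ∘ (τ : Equiv.Perm (Fin d)) ∘ (ρ : Equiv.Perm (Fin d)) = G :=
    by_contra fun hne => h (Finsupp.single_eq_of_ne' hne)
  refine sum_cellRow_mul_lt T hF.2 ρ.2 τ.2 fun hτ => hGF ?_
  rw [hτ] at hG ⊢
  exact e.injective.comp_left (hF.1.comp_eq (cell_injective T) ρ.2 hG.1)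

theorem linearIndependent_symmVec [CharZero k] (P : Set (Fin d → α)) :
    LinearIndependent k
      fun G : {G ∈ P | IsSemistandard T (e ∘ G)} => symmVec T k (G : Fin d → α) :=
  linearIndependent_of_triangular (fun G => G.1) (fun G => ∑ z, cellRow T z * e (G.1 z))
    (fun G => symmVec_apply_self_ne_zero T e G.2.2) fun G F hne h =>
      sum_cellRow_mul_lt_of_symmVec_apply_ne_zero T e F.2.2 G.2.2 (Subtype.coe_ne_coe.mpr hne) h

theorem finrank_map_youngSymmetrizer_supported [CharZero k] {P : Set (Fin d → α)}
    (hP : ∀ F ∈ P, ∀ σ : Equiv.Perm (Fin d), F ∘ σ ∈ P) :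
    Module.finrank k ((Finsupp.supported k k P).map
        ((fillingRep k (Fin d) α).asAlgebraHom (youngSymmetrizer k T))) =
      {G ∈ P | IsSemistandard T (e ∘ G)}.ncard := by
  have hspan : (Finsupp.supported k k P).map
      ((fillingRep k (Fin d) α).asAlgebraHom (youngSymmetrizer k T)) =
      Submodule.span k (Set.range
        fun G : {G ∈ P | IsSemistandard T (e ∘ G)} => symmVec T k (G : Fin d → α)) := by
    rw [Finsupp.supported_eq_span_single, Submodule.map_span, Set.image_image,
      ← Set.image_eq_range]
    refine le_antisymm (Submodule.span_le.mpr ?_)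
      (Submodule.span_mono (Set.image_mono fun G hG => hG.1))
    rintro _ ⟨F, hF, rfl⟩
    exact symmVec_mem_span T e hP hF
  rw [hspan, Module.finrank_eq_nat_card_basis (Module.Basis.span (linearIndependent_symmVec T e P)),
    Nat.card_coe_set_eq]

end Independence

section SemistandardFilling

variable {μ : YoungDiagram}

/-- The semistandard tableau with given entries in the cells of `μ`. -/
def ofFilling (F : μ.cells → ℕ)
    (hrow : FiberMonotone (fun c : μ.cells => c.1.1) (fun c => c.1.2) F)
    (hcol : FiberStrictMono (fun c : μ.cells => c.1.2) (fun c => c.1.1) F) :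
    SemistandardYoungTableau μ where
  entry i j := if h : (i, j) ∈ μ.cells then F ⟨(i, j), h⟩ else 0
  row_weak' {i j₁ j₂} hj h := by
    have h₁ : (i, j₁) ∈ μ.cells := μ.up_left_mem le_rfl hj.le h
    have h₂ : (i, j₂) ∈ μ.cells := h
    rw [dif_pos h₁, dif_pos h₂]
    exact hrow (z := ⟨_, h₁⟩) (z' := ⟨_, h₂⟩) rfl hj
  col_strict' {i₁ i₂ j} hi h := by
    have h₁ : (i₁, j) ∈ μ.cells := μ.up_left_mem hi.le le_rfl h
    have h₂ : (i₂, j) ∈ μ.cells := h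
    rw [dif_pos h₁, dif_pos h₂]
    exact hcol (z := ⟨_, h₁⟩) (z' := ⟨_, h₂⟩) rfl hi
  zeros' h := dif_neg h

theorem ofFilling_apply (F : μ.cells → ℕ) (hrow) (hcol) (c : μ.cells) :
    ofFilling F hrow hcol c.1.1 c.1.2 = F c :=
  dif_pos c.2

theorem semistandardYoungTableau_ext_cells {S S' : SemistandardYoungTableau μ}
    (h : ∀ c : μ.cells, S c.1.1 c.1.2 = S' c.1.1 c.1.2) : S = S' := by
  refine SemistandardYoungTableau.ext fun i j => ?_
  by_cases hc : (i, j) ∈ μ.cells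
  · exact h ⟨(i, j), hc⟩
  · rw [S.zeros hc, S'.zeros hc]

end SemistandardFilling

section SchurPolynomial

open MvPolynomial

variable {μ : YoungDiagram} {d : ℕ} (T : μ.cells ≃ Fin d)

instance : DecidablePred (IsSemistandard T) := Classical.decPred _

theorem sum_isSemistandard_eq {α M : Type*} [Fintype α] [AddCommMonoid M] (e e' : α ↪ ℕ)
    {Ψ : (Fin d → α) → M} (hΨ : ∀ F, ∀ σ : Equiv.Perm (Fin d), Ψ (F ∘ σ) = Ψ F) :
    ∑ G with IsSemistandard T (e ∘ G), Ψ G = ∑ G with IsSemistandard T (e' ∘ G), Ψ G := by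
  classical
  have hfiber (e : α ↪ ℕ) (y : M) :
      ∑ G ∈ {G | IsSemistandard T (e ∘ G)} with Ψ G = y, Ψ G =
        Module.finrank ℚ ((Finsupp.supported ℚ ℚ {G | Ψ G = y}).map
          ((fillingRep ℚ (Fin d) α).asAlgebraHom (youngSymmetrizer ℚ T))) • y := by
    rw [finrank_map_youngSymmetrizer_supported (P := {G | Ψ G = y}) T e
      fun F hF σ => (hΨ F σ).trans hF,
      Finset.sum_congr rfl fun G hG => (Finset.mem_filter.mp hG).2, Finset.sum_const,
      ← Set.ncard_coe_finset]
    congr 2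
    ext G
    simp [and_comm]
  have hmaps (G : Fin d → α) : Ψ G ∈ Finset.univ.image Ψ :=
    Finset.mem_image_of_mem Ψ (Finset.mem_univ G)
  rw [← Finset.sum_fiberwise_of_maps_to fun G _ => hmaps G,
    ← Finset.sum_fiberwise_of_maps_to fun G _ => hmaps G]
  simp only [hfiber]

/-- A semistandard tableau, as a filling of the numbered cells. -/
def boundedSSYTEquiv (N : ℕ) :
    BoundedSSYT μ N ≃ {G : Fin d → Fin N // IsSemistandard T (Fin.valEmbedding ∘ G)} where
  toFun S :=
    ⟨fun z => ⟨S.1 (cellRow T z) (cellCol T z), S.2 (T.symm z)⟩,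
      fun z z' hr hc => by
        simpa [hr] using S.1.row_weak hc (cell_mem T z'),
      fun z z' hc hr => by
        simpa [hc] using S.1.col_strict hr (cell_mem T z')⟩
  invFun G :=
    ⟨ofFilling (fun c => G.1 (T c))
      (fun c c' hr hc => G.2.1 (z := T c) (z' := T c')
        (by simpa [cellRow] using hr) (by simpa [cellCol] using hc))
      (fun c c' hc hr => G.2.2 (z := T c) (z' := T c')
        (by simpa [cellCol] using hc) (by simpa [cellRow] using hr)),
      fun c => (ofFilling_apply _ _ _ c).trans_lt (G.1 _).2⟩
  left_inv S := by
    refine Subtype.ext (semistandardYoungTableau_ext_cells fun c => ?_)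
    exact (dif_pos c.2).trans (by simp [cellRow, cellCol])
  right_inv G := by
    refine Subtype.ext (funext fun z => Fin.ext ?_)
    exact (dif_pos (cell_mem T z)).trans (by simp [cellRow, cellCol])

theorem schurPolynomial_eq_sum (N : ℕ) :
    schurPolynomial μ N =
      ∑ G : Fin d → Fin N with IsSemistandard T (Fin.valEmbedding ∘ G), ∏ z, X (G z) := by
  rw [schurPolynomial, Finset.sum_subtype _ fun G => Finset.mem_filter_univ G]
  refine Fintype.sum_equiv (boundedSSYTEquiv T N) _ _ fun S => ?_
  exact Fintype.prod_equiv T _ _ fun c => by simp [boundedSSYTEquiv, cellRow, cellCol]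

theorem schurPolynomial_isSymmetric (μ : YoungDiagram) (N : ℕ) :
    (schurPolynomial μ N).IsSymmetric := by
  intro π
  let T : μ.cells ≃ Fin μ.card := μ.cells.equivFin
  have hrename :
      rename π (schurPolynomial μ N) =
        ∑ G : Fin μ.card → Fin N with
          IsSemistandard T (π.symm.toEmbedding.trans Fin.valEmbedding ∘ G), ∏ z, X (G z) := by
    simp only [schurPolynomial_eq_sum T, map_sum, map_prod, rename_X]
    exact Finset.sum_equiv ((Equiv.refl _).arrowCongr π)
      (fun G => by simp [Function.comp_def]) fun G _ => by simp
  rw [hrename, schurPolynomial_eq_sum T]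
  exact sum_isSemistandard_eq T _ _ fun F σ => Equiv.prod_comp σ fun z => X (F z)

theorem principalSchur_eq_sum_fillings (m : ℕ) :
    principalSchur μ m =
      ∑ G : Fin d → Fin (m + 1) with IsSemistandard T (Fin.valEmbedding ∘ G),
        Polynomial.X ^ ∑ z, (G z : ℕ) := by
  simp [principalSchur, schurPolynomial_eq_sum T, Finset.prod_pow_eq_pow_sum]

/-- Since the Schur polynomial is symmetric, its variables may be specialised in the reverse
order. -/
theorem principalSchur_eq_sum_sub (μ : YoungDiagram) (m : ℕ) :
    principalSchur μ m =
      ∑ S : BoundedSSYT μ (m + 1), Polynomial.X ^ ∑ c : μ.cells, (m - S.1 c.1.1 c.1.2) := by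
  rw [principalSchur, ← schurPolynomial_isSymmetric μ (m + 1) Fin.revPerm, aeval_rename]
  simp [schurPolynomial, Finset.prod_pow_eq_pow_sum, Fin.val_rev]

end SchurPolynomial

section SpechtHom

theorem map_asAlgebraHom {k G V W : Type*} [CommSemiring k] [Monoid G] [AddCommMonoid V]
    [Module k V] [AddCommMonoid W] [Module k W] {ρ : Representation k G V}
    {σ : Representation k G W} (φ : V →ₗ[k] W) (hφ : ∀ g v, φ (ρ g v) = σ g (φ v))
    (x : MonoidAlgebra k G) (v : V) :
    φ (ρ.asAlgebraHom x v) = σ.asAlgebraHom x (φ v) := by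
  induction x using MonoidAlgebra.induction_linear with
  | zero => simp
  | add x y hx hy => simp only [map_add, LinearMap.add_apply, hx, hy]
  | single g a => simp [Representation.asAlgebraHom_single, hφ]

variable {k : Type*} [Field k] {μ : YoungDiagram} {d : ℕ} (T : μ.cells ≃ Fin d)
  {V : Type*} [AddCommMonoid V] [Module k V] (ρ : Representation k (Equiv.Perm (Fin d)) V)

/-- The Young symmetrizer as an element of the Specht module. -/
def spechtGen (k : Type*) [Field k] : spechtModule k T :=
  ⟨youngSymmetrizer k T, 1, one_mul _⟩

theorem coe_spechtRep (σ : Equiv.Perm (Fin d)) (x : spechtModule k T) :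
    (spechtRep k T σ x).1 = MonoidAlgebra.single σ 1 * x.1 := rfl

/-- The equivariant map `x ↦ x • v` from the Specht module to a representation. -/
def spechtHom (v : V) : Representation.IntertwiningMap (spechtRep k T) ρ where
  toLinearMap := ρ.asAlgebraHom.toLinearMap.flip v ∘ₗ (spechtModule k T).subtype
  isIntertwining' σ := LinearMap.ext fun x => by
    simp only [LinearMap.comp_apply, Submodule.subtype_apply, LinearMap.flip_apply,
      AlgHom.toLinearMap_apply, coe_spechtRep, map_mul, Module.End.mul_apply,
      Representation.asAlgebraHom_single_one]

theorem spechtHom_apply (v : V) (x : spechtModule k T) :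
    spechtHom T ρ v x = ρ.asAlgebraHom x.1 v := rfl

theorem coe_asAlgebraHom_spechtRep (x : MonoidAlgebra k (Equiv.Perm (Fin d)))
    (v : spechtModule k T) :
    ((spechtRep k T).asAlgebraHom x v : spechtModule k T).1 = x * v.1 := by
  induction x using MonoidAlgebra.induction_linear with
  | zero => simp
  | add x y hx hy => simp only [map_add, LinearMap.add_apply, Submodule.coe_add, hx, hy, add_mul]
  | single σ a =>
    rw [Representation.asAlgebraHom_single, LinearMap.smul_apply, Submodule.coe_smul,
      coe_spechtRep, ← smul_mul_assoc, MonoidAlgebra.smul_single, smul_eq_mul, mul_one]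

theorem exists_eq_asAlgebraHom_spechtGen (v : spechtModule k T) :
    ∃ x, v = (spechtRep k T).asAlgebraHom x (spechtGen T k) := by
  obtain ⟨x, hx⟩ := v.2
  refine ⟨x, Subtype.ext ?_⟩
  rw [coe_asAlgebraHom_spechtRep, ← hx]
  rfl

theorem spechtHom_ext {ρ : Representation k (Equiv.Perm (Fin d)) V}
    {f f' : Representation.IntertwiningMap (spechtRep k T) ρ}
    (h : f (spechtGen T k) = f' (spechtGen T k)) : f = f' := by
  refine Representation.IntertwiningMap.ext (LinearMap.ext fun v => ?_)
  obtain ⟨x, rfl⟩ := exists_eq_asAlgebraHom_spechtGen T v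
  rw [map_asAlgebraHom f.toLinearMap f.isIntertwining,
    map_asAlgebraHom f'.toLinearMap f'.isIntertwining]
  exact congrArg _ h

/-- If `c * y * c = c` for the Young symmetrizer `c`, then `f c = c • f (y * c)`. -/
theorem exists_spechtHom_apply_eq [CharZero k] :
    ∃ x : spechtModule k T, ∀ f : Representation.IntertwiningMap (spechtRep k T) ρ,
      spechtHom T ρ (f x) = f := by
  obtain ⟨y, hy⟩ := exists_mul_mul_eq_self (youngSymmetrizer k T)
  refine ⟨⟨y * youngSymmetrizer k T, y, rfl⟩, fun f => spechtHom_ext T ?_⟩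
  have hmap := map_asAlgebraHom f.toLinearMap f.isIntertwining (youngSymmetrizer k T)
    ⟨y * youngSymmetrizer k T, y, rfl⟩
  refine hmap.symm.trans (congrArg f (Subtype.ext ?_))
  rw [coe_asAlgebraHom_spechtRep, ← mul_assoc]
  exact hy

end SpechtHom

section CovariantPiece

variable {k : Type*} [Field k] {μ : YoungDiagram} {d n m : ℕ} (T : μ.cells ≃ Fin d)

theorem glRepA_lof (g : Matrix.GeneralLinearGroup (Fin (n + 1)) k) (x : segrePiece k d n m) :
    glRepA k d n g (DirectSum.lof k ℕ (fun m => segrePiece k d n m) m x) =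
      DirectSum.lof k ℕ (fun m => segrePiece k d n m) m (glRepPiece k d n m g x) := by
  simp [glRepA, Representation.directSum]

theorem asAlgebraHom_permRepA_lof (y : MonoidAlgebra k (Equiv.Perm (Fin d)))
    (x : segrePiece k d n m) :
    (permRepA k d n).asAlgebraHom y (DirectSum.lof k ℕ (fun m => segrePiece k d n m) m x) =
      DirectSum.lof k ℕ (fun m => segrePiece k d n m) m
        ((permRepPiece k d n m).asAlgebraHom y x) :=
  (map_asAlgebraHom (DirectSum.lof k ℕ (fun m => segrePiece k d n m) m)
    (fun g v => by simp [permRepA, Representation.directSum]) y x).symm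

/-- Evaluation of a covariant of degree `m` at the Young symmetrizer. -/
def evalGen (k : Type*) [Field k] (n m : ℕ) :
    (covariantPiece k n T m).toSubmodule →ₗ[k] segrePiece k d n m where
  toFun f := DirectSum.component k ℕ (fun m => segrePiece k d n m) m (f.1 (spechtGen T k))
  map_add' _ _ := rfl
  map_smul' _ _ := rfl

theorem lof_component {f : CovariantModule k n T} (hf : f ∈ (covariantPiece k n T m).toSubmodule)
    (v : spechtModule k T) :
    DirectSum.lof k ℕ (fun m => segrePiece k d n m) m (DirectSum.component k ℕ _ m (f v)) =
      f v := by
  obtain ⟨x, hx⟩ := hf v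
  rw [← hx, DirectSum.component.lof_self]

theorem evalGen_injective : Function.Injective (evalGen T k n m) := fun f f' h =>
  Subtype.ext <| spechtHom_ext T <| by
    rw [← lof_component T f.2, ← lof_component T f'.2]
    exact congrArg _ h

/-- The covariant of degree `m` sending the Young symmetrizer `c` to `c • x`. -/
def covariantOf (x : segrePiece k d n m) : (covariantPiece k n T m).toSubmodule :=
  ⟨spechtHom T (permRepA k d n) (DirectSum.lof k ℕ (fun m => segrePiece k d n m) m x), fun v => by
    rw [spechtHom_apply, asAlgebraHom_permRepA_lof]
    exact LinearMap.mem_range_self _ _⟩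

theorem covariantOf_apply (x : segrePiece k d n m) (v : spechtModule k T) :
    (covariantOf T x).1 v = DirectSum.lof k ℕ (fun m => segrePiece k d n m) m
      ((permRepPiece k d n m).asAlgebraHom v.1 x) :=
  asAlgebraHom_permRepA_lof _ _

theorem evalGen_covariantOf (x : segrePiece k d n m) :
    evalGen T k n m (covariantOf T x) =
      (permRepPiece k d n m).asAlgebraHom (youngSymmetrizer k T) x :=
  (congrArg (DirectSum.component k ℕ _ m) (covariantOf_apply T x (spechtGen T k))).trans
    (DirectSum.component.lof_self _ _ _)

theorem toRepresentation_covariantOf (g : Matrix.GeneralLinearGroup (Fin (n + 1)) k)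
    (x : segrePiece k d n m) :
    (covariantPiece k n T m).toRepresentation g (covariantOf T x) =
      covariantOf T (glRepPiece k d n m g x) := by
  refine Subtype.ext (Representation.IntertwiningMap.ext (LinearMap.ext fun v => ?_))
  change glRepA k d n g ((permRepA k d n).asAlgebraHom v.1 _) = (permRepA k d n).asAlgebraHom v.1 _
  rw [← glRepA_lof]
  exact map_asAlgebraHom _ (fun σ => LinearMap.congr_fun (glRepA_permRepA_comm k d n g σ)) _ _

theorem map_evalGen_weightSpace [CharZero k] (i j : ℕ) :
    (weightSpace (covariantPiece k 1 T m).toRepresentation i j).map (evalGen T k 1 m) =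
      (weightSpace (glRepPiece k d 1 m) i j).map
        ((permRepPiece k d 1 m).asAlgebraHom (youngSymmetrizer k T)) := by
  refine le_antisymm ?_ ?_
  · rintro _ ⟨f, hf, rfl⟩
    obtain ⟨v, hv⟩ := exists_spechtHom_apply_eq T (permRepA k d 1)
    set x := DirectSum.component k ℕ _ m (f.1 v)
    have hfx : covariantOf T x = f :=
      Subtype.ext ((congrArg _ (lof_component T f.2 v)).trans (hv f.1))
    refine ⟨x, fun t₁ t₂ => ?_, by rw [← hfx, evalGen_covariantOf]⟩
    have hfv : glRepA k d 1 (torusElt t₁ t₂) (f.1 v) = ((t₁ : k) ^ i * (t₂ : k) ^ j) • f.1 v :=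
      congrArg (fun g => g.1 v) (hf t₁ t₂)
    rw [← lof_component T f.2 v, glRepA_lof, ← map_smul] at hfv
    exact DirectSum.of_injective (β := fun m => segrePiece k d 1 m) m hfv
  · rintro _ ⟨x, hx, rfl⟩
    refine ⟨covariantOf T x, fun t₁ t₂ => ?_, evalGen_covariantOf T x⟩
    rw [toRepresentation_covariantOf, hx t₁ t₂]
    exact Subtype.ext (spechtHom_ext T (by simp [covariantOf, spechtHom_apply]))

end CovariantPiece

section MonomialBasis

theorem weight_multiWeight_apply {d n : ℕ} (s : Fin d × Fin (n + 1) →₀ ℕ) (z : Fin d) :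
    Finsupp.weight (multiWeight d n) s z = ∑ j, s (z, j) := by
  rw [Finsupp.weight_apply, Finsupp.sum_fintype _ _ (by simp), Finset.sum_apply,
    Fintype.sum_prod_type]
  simp [multiWeight, Pi.single_apply]

/-- The exponents of the monomials of multidegree `(m, …, m)` in the variables `u₀`, `u₁`: the
filling `G` stands for the exponent `G z` of `u₀` and `m - G z` of `u₁` in the factor `z`. -/
def exponentEquiv (d m : ℕ) : (Fin d → Fin (m + 1)) ≃
    {s : Fin d × Fin (1 + 1) →₀ ℕ | Finsupp.weight (multiWeight d 1) s = fun _ => m} where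
  toFun G := ⟨Finsupp.equivFunOnFinite.symm fun p => ![(G p.1 : ℕ), m - G p.1] p.2,
    funext fun z => by simp [weight_multiWeight_apply, Fin.sum_univ_two]; lia⟩
  invFun s := fun z => ⟨s.1 (z, 0), by
    have h := congrFun s.2 z
    rw [weight_multiWeight_apply, Fin.sum_univ_two] at h
    lia⟩
  left_inv G := by ext; simp
  right_inv s := Subtype.ext <| Finsupp.ext fun ⟨z, j⟩ => by
    have h := congrFun s.2 z
    rw [weight_multiWeight_apply, Fin.sum_univ_two] at h
    fin_cases j
    · rfl
    · exact Nat.sub_eq_of_eq_add' h.symm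

/-- The monomial basis of `Sym^m U ⊗ ⋯ ⊗ Sym^m U` for `dim U = 2`. -/
def segreBasis (k : Type*) [Field k] (d m : ℕ) :
    Module.Basis (Fin d → Fin (m + 1)) k (segrePiece k d 1 m) :=
  ((MvPolynomial.basisRestrictSupport k _).reindex (exponentEquiv d m).symm).map
    (LinearEquiv.ofEq (MvPolynomial.restrictSupport k _) _
      (MvPolynomial.weightedHomogeneousSubmodule_eq_finsupp_supported _ _ _).symm)

variable {k : Type*} [Field k] {d m : ℕ}

theorem coe_segreBasis (G : Fin d → Fin (m + 1)) :
    (segreBasis k d m G : CoordRing k d 1) = MvPolynomial.monomial (exponentEquiv d m G) 1 := by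
  have hmem : MvPolynomial.monomial (exponentEquiv d m G).1 (1 : k) ∈ segrePiece k d 1 m :=
    MvPolynomial.isWeightedHomogeneous_monomial _ _ _ (exponentEquiv d m G).2
  refine congrArg Subtype.val (a₂ := ⟨_, hmem⟩) ((segreBasis k d m).apply_eq_iff.mpr ?_)
  refine Finsupp.ext fun F => (MvPolynomial.coeff_monomial _ _ _).trans ?_
  simp only [Finsupp.single_apply, Subtype.coe_inj, Equiv.symm_symm,
    EmbeddingLike.apply_eq_iff_eq]

theorem permRepPiece_segreBasis (σ : Equiv.Perm (Fin d)) (G : Fin d → Fin (m + 1)) :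
    permRepPiece k d 1 m σ (segreBasis k d m G) = segreBasis k d m (G ∘ ⇑σ⁻¹) := by
  refine Subtype.ext ?_
  change MvPolynomial.rename (Prod.map σ id) (segreBasis k d m G : CoordRing k d 1) = _
  rw [coe_segreBasis, coe_segreBasis, MvPolynomial.rename_monomial]
  refine congrArg (MvPolynomial.monomial · 1) (Finsupp.ext fun ⟨z, j⟩ => ?_)
  rw [show (z, j) = Prod.map σ id (σ⁻¹ z, j) by simp,
    Finsupp.mapDomain_apply (σ.injective.prodMap Function.injective_id)]
  simp [exponentEquiv]

theorem glSubst_torusElt_X (t₁ t₂ : kˣ) (p : Fin d × Fin (1 + 1)) :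
    glSubst (torusElt t₁ t₂ : Matrix.GeneralLinearGroup (Fin (1 + 1)) k).1
      (MvPolynomial.X p : CoordRing k d 1) =
      MvPolynomial.C (![(t₁ : k), t₂] p.2) * MvPolynomial.X p := by
  rw [glSubst, MvPolynomial.aeval_X, Finset.sum_eq_single_of_mem p.2 (Finset.mem_univ _)]
  · simp [torusElt]
  · intro j _ hj
    simp [torusElt, hj]

theorem glRepPiece_torusElt_segreBasis (t₁ t₂ : kˣ) (G : Fin d → Fin (m + 1)) :
    glRepPiece k d 1 m (torusElt t₁ t₂) (segreBasis k d m G) =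
      ((t₁ : k) ^ (∑ z, (G z : ℕ)) * (t₂ : k) ^ ∑ z, (m - G z)) • segreBasis k d m G := by
  refine Subtype.ext ?_
  change glSubst (torusElt t₁ t₂ : Matrix.GeneralLinearGroup (Fin (1 + 1)) k).1
    (segreBasis k d m G : CoordRing k d 1) = _ • (segreBasis k d m G : CoordRing k d 1)
  rw [coe_segreBasis, MvPolynomial.monomial_eq, map_mul, map_finsuppProd]
  simp only [map_pow, glSubst_torusElt_X, mul_pow, Finsupp.prod_mul]
  rw [Finsupp.prod_fintype _ _ (by simp), Fintype.prod_prod_type]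
  simp [exponentEquiv, Fin.prod_univ_two, Finset.prod_mul_distrib, Finset.prod_pow_eq_pow_sum,
    MvPolynomial.smul_eq_C_mul]

/-- The characters `t₁ ^ i * t₂ ^ j` are told apart by their values at `(2, 1)` and `(1, 2)`. -/
theorem weightSpace_eq_span {ι L : Type*} [CharZero k] [AddCommGroup L] [Module k L]
    (ρ : Representation k (Matrix.GeneralLinearGroup (Fin (1 + 1)) k) L)
    (b : Module.Basis ι k L) {α β : ι → ℕ}
    (hb : ∀ t₁ t₂ x, ρ (torusElt t₁ t₂) (b x) = ((t₁ : k) ^ α x * (t₂ : k) ^ β x) • b x)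
    (i j : ℕ) : weightSpace ρ i j = Submodule.span k (b '' {x | α x = i ∧ β x = j}) := by
  have hcoord (t₁ t₂ : kˣ) (v : L) (x : ι) :
      b.repr (ρ (torusElt t₁ t₂) v) x = (t₁ : k) ^ α x * (t₂ : k) ^ β x * b.repr v x := by
    have h : b.coord x ∘ₗ ρ (torusElt t₁ t₂) = ((t₁ : k) ^ α x * (t₂ : k) ^ β x) • b.coord x :=
      b.ext fun y => by
        by_cases hxy : y = x
        · simp [hb, hxy]
        · simp [hb, Finsupp.single_eq_of_ne' hxy]
    exact LinearMap.congr_fun h v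
  refine le_antisymm (fun v hv => ?_) (Submodule.span_le.mpr ?_)
  · refine b.mem_span_image.mpr fun x hx => ?_
    have hchar (t₁ t₂ : kˣ) : (t₁ : k) ^ α x * (t₂ : k) ^ β x = (t₁ : k) ^ i * (t₂ : k) ^ j := by
      refine mul_right_cancel₀ (Finsupp.mem_support_iff.mp hx) ?_
      rw [← hcoord, hv t₁ t₂, map_smul, Finsupp.smul_apply, smul_eq_mul]
    have hpow {a b : ℕ} (h : (2 : k) ^ a = 2 ^ b) : a = b :=
      Nat.pow_right_injective le_rfl (by exact_mod_cast h)
    exact ⟨hpow (by simpa using hchar (Units.mk0 2 two_ne_zero) 1),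
      hpow (by simpa using hchar 1 (Units.mk0 2 two_ne_zero))⟩
  · rintro _ ⟨x, ⟨rfl, rfl⟩, rfl⟩ t₁ t₂
    exact hb t₁ t₂ x

end MonomialBasis

section Character

variable {k : Type*} [Field k] [CharZero k] {μ : YoungDiagram} {d : ℕ} (T : μ.cells ≃ Fin d)

theorem finrank_map_youngSymmetrizer_span {α V : Type*} [AddCommGroup V] [Module k V]
    {ρ : Representation k (Equiv.Perm (Fin d)) V} (b : Module.Basis (Fin d → α) k V)
    (hb : ∀ σ F, ρ σ (b F) = b (F ∘ ⇑σ⁻¹)) (e : α ↪ ℕ) {P : Set (Fin d → α)}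
    (hP : ∀ F ∈ P, ∀ σ : Equiv.Perm (Fin d), F ∘ σ ∈ P) :
    Module.finrank k ((Submodule.span k (b '' P)).map
      (ρ.asAlgebraHom (youngSymmetrizer k T))) = {G ∈ P | IsSemistandard T (e ∘ G)}.ncard := by
  have hspan : Submodule.span k (b '' P) =
      (Finsupp.supported k k P).map b.repr.symm.toLinearMap := by
    simp [Finsupp.supported_eq_span_single, Submodule.map_span, Set.image_image]
  have hcomm : ρ.asAlgebraHom (youngSymmetrizer k T) ∘ₗ b.repr.symm.toLinearMap =
      b.repr.symm.toLinearMap ∘ₗ (fillingRep k (Fin d) α).asAlgebraHom (youngSymmetrizer k T) := by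
    refine LinearMap.ext fun v => (map_asAlgebraHom _ (fun σ v => ?_) _ v).symm
    exact LinearMap.congr_fun (f := b.repr.symm.toLinearMap ∘ₗ fillingRep k (Fin d) α σ)
      (g := ρ σ ∘ₗ b.repr.symm.toLinearMap)
      (Finsupp.lhom_ext fun F a => by simp [fillingRep_single, hb]) v
  rw [hspan, ← Submodule.map_comp, hcomm, Submodule.map_comp,
    ← finrank_map_youngSymmetrizer_supported (k := k) T e hP]
  exact LinearEquiv.finrank_map_eq b.repr.symm _

theorem finrank_weightSpace (m i j : ℕ) :
    Module.finrank k (weightSpace (covariantPiece k 1 T m).toRepresentation i j) =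
      {G : Fin d → Fin (m + 1) | (∑ z, (G z : ℕ) = i ∧ ∑ z, (m - G z) = j) ∧
        IsSemistandard T (Fin.valEmbedding ∘ G)}.ncard := by
  rw [(Submodule.equivMapOfInjective _ (evalGen_injective T) _).finrank_eq,
    map_evalGen_weightSpace,
    weightSpace_eq_span _ (segreBasis k d m) glRepPiece_torusElt_segreBasis,
    finrank_map_youngSymmetrizer_span T _ permRepPiece_segreBasis Fin.valEmbedding]
  · rfl
  · rintro G ⟨rfl, rfl⟩ σ
    exact ⟨Equiv.sum_comp σ fun z => (G z : ℕ), Equiv.sum_comp σ fun z => m - (G z : ℕ)⟩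

theorem character_eq_principalSchur (m : ℕ) :
    character (L := (covariantPiece k 1 T m).toSubmodule) (d * m)
      (covariantPiece k 1 T m).toRepresentation = principalSchur μ m := by
  have hsum (G : Fin d → Fin (m + 1)) : ∑ z, (G z : ℕ) + ∑ z, (m - G z) = d * m := by
    rw [← Finset.sum_add_distrib, Finset.sum_congr rfl fun z _ =>
      Nat.add_sub_cancel' (Fin.is_le (G z))]
    simp
  have hmaps (G : Fin d → Fin (m + 1)) : ∑ z, (G z : ℕ) ∈ Finset.range (d * m + 1) := by
    have := hsum G
    exact Finset.mem_range.mpr (by lia)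
  rw [character, principalSchur_eq_sum_fillings T,
    ← Finset.sum_fiberwise_of_maps_to fun G _ => hmaps G]
  refine Finset.sum_congr rfl fun i _ => ?_
  have hcount : {G : Fin d → Fin (m + 1) | (∑ z, (G z : ℕ) = i ∧ ∑ z, (m - G z) = d * m - i) ∧
      IsSemistandard T (Fin.valEmbedding ∘ G)} =
      (({G : Fin d → Fin (m + 1) | IsSemistandard T (Fin.valEmbedding ∘ G)} : Finset _).filter
        fun G => ∑ z, (G z : ℕ) = i : Finset _) := by
    ext G
    have := hsum G
    simp only [Set.mem_ofPred_eq, Finset.coe_filter, Finset.mem_filter, Finset.mem_univ, true_and]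
    constructor
    · rintro ⟨⟨h, -⟩, hG⟩
      exact ⟨hG, h⟩
    · rintro ⟨hG, h⟩
      exact ⟨⟨h, by lia⟩, hG⟩
  rw [finrank_weightSpace, hcount, Set.ncard_coe_finset, ← nsmul_eq_mul, ← Finset.sum_const]
  exact Finset.sum_congr rfl fun G hG => by rw [(Finset.mem_filter.mp hG).2]

end Character

section Standardization

theorem existsUnique_equiv_strictMono_comp_symm {κ α β : Type*} [Fintype κ] [Fintype β]
    [LinearOrder α] [LinearOrder β] (hcard : Fintype.card κ = Fintype.card β) {f : κ → α}
    (hf : Function.Injective f) : ∃! e : κ ≃ β, StrictMono (f ∘ e.symm) := by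
  classical
  let toRange := Equiv.ofInjective f hf
  have hrange : Fintype.card (Set.range f) = Fintype.card β :=
    (Fintype.card_congr toRange).symm.trans hcard
  let sort : β ≃o Set.range f := (monoEquivOfFin β rfl).symm.trans (monoEquivOfFin _ hrange)
  have hsort : f ∘ (toRange.trans sort.symm.toEquiv).symm = Subtype.val ∘ sort :=
    funext fun y => Equiv.apply_ofInjective_symm hf (sort y)
  refine ⟨toRange.trans sort.symm.toEquiv, ?_, fun e he => ?_⟩
  · beta_reduce
    rw [hsort]
    exact (Subtype.strictMono_coe _).comp sort.strictMono
  · have heq : f ∘ e.symm = Subtype.val ∘ sort :=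
      (he.range_inj ((Subtype.strictMono_coe _).comp sort.strictMono)).mp (by
        rw [e.symm.surjective.range_comp, sort.surjective.range_comp, Subtype.range_coe])
    exact Equiv.symm_bijective.injective
      (Equiv.coe_fn_injective (hf.comp_left (heq.trans hsort.symm)))

variable {μ : YoungDiagram}

namespace StandardTableau

theorem apply_mem_Icc (T : StandardTableau μ) (c : μ.cells) : 1 ≤ (T.1 c : ℕ) ∧ T.1 c ≤ μ.card :=
  Finset.mem_Icc.mp (T.1 c).2

theorem exists_apply_eq (T : StandardTableau μ) {t : ℕ} (h₁ : 1 ≤ t) (h₂ : t ≤ μ.card) :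
    ∃ c, (T.1 c : ℕ) = t :=
  ⟨T.1.symm ⟨t, Finset.mem_Icc.mpr ⟨h₁, h₂⟩⟩, by simp⟩

theorem apply_le_apply (T : StandardTableau μ) {c c' : μ.cells} (h : c.1 ≤ c'.1) :
    T.1 c ≤ T.1 c' := by
  have hmem : (c.1.1, c'.1.2) ∈ μ.cells := μ.up_left_mem h.1 le_rfl c'.2
  let corner : μ.cells := ⟨(c.1.1, c'.1.2), hmem⟩
  calc T.1 c ≤ T.1 corner := by
        rcases h.2.eq_or_lt with hcol | hcol
        · exact (congrArg T.1 (show c = corner from Subtype.ext (Prod.ext rfl hcol))).le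
        · exact (T.2.1 c corner rfl hcol).le
    _ ≤ T.1 c' := by
        rcases h.1.eq_or_lt with hrow | hrow
        · exact (congrArg T.1 (show corner = c' from Subtype.ext (Prod.ext hrow rfl))).le
        · exact (T.2.2 corner c' rfl hrow).le

theorem lt_of_forall_lt_of_apply_eq_succ {α : Type*} [Preorder α] (T : StandardTableau μ)
    {f : μ.cells → α} (hf : ∀ c c', (T.1 c' : ℕ) = T.1 c + 1 → f c < f c') {c c' : μ.cells}
    (h : T.1 c < T.1 c') : f c < f c' := by
  have hgap (n : ℕ) : ∀ c', (T.1 c' : ℕ) = T.1 c + 1 + n → f c < f c' := by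
    induction n with
    | zero => exact fun c' hc' => hf c c' hc'
    | succ n ih =>
      intro c' hc'
      obtain ⟨b, hb⟩ := T.exists_apply_eq (t := T.1 c + 1 + n) (by lia)
        (by have := T.apply_mem_Icc c'; lia)
      exact (ih b hb).trans (hf b c' (by lia))
  obtain ⟨n, hn⟩ := Nat.exists_eq_add_of_le (Nat.succ_le_of_lt (Subtype.coe_lt_coe.mpr h))
  exact hgap n c' hn

/-- Otherwise the cell in the row of `c'` and the column of `c` would carry an entry strictly
between those of `c` and `c'`. -/
theorem col_le_iff_row_lt (T : StandardTableau μ) {c c' : μ.cells}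
    (h : (T.1 c' : ℕ) = T.1 c + 1) : c'.1.2 ≤ c.1.2 ↔ c.1.1 < c'.1.1 := by
  constructor
  · intro hcol
    by_contra! hrow
    have : (T.1 c' : ℕ) ≤ T.1 c := T.apply_le_apply ⟨hrow, hcol⟩
    lia
  · intro hrow
    by_contra! hcol
    have hmem : (c'.1.1, c.1.2) ∈ μ.cells := μ.up_left_mem le_rfl hcol.le c'.2
    have h₁ : (T.1 c : ℕ) < T.1 ⟨_, hmem⟩ := T.2.2 c ⟨_, hmem⟩ rfl hrow
    have h₂ : (T.1 ⟨_, hmem⟩ : ℕ) < T.1 c' := T.2.1 ⟨_, hmem⟩ c' rfl hcol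
    lia

theorem mem_descents_iff (T : StandardTableau μ) {c c' : μ.cells}
    (h : (T.1 c' : ℕ) = T.1 c + 1) : (T.1 c : ℕ) ∈ descents T ↔ c'.1.2 ≤ c.1.2 := by
  rw [T.col_le_iff_row_lt h, descents, Finset.mem_filter]
  constructor
  · rintro ⟨-, b, b', hb, hb', hrow⟩
    rwa [T.1.injective (Subtype.ext hb), T.1.injective (Subtype.ext (hb'.trans h.symm))] at hrow
  · exact fun hrow => ⟨(T.1 c).2, c, c', rfl, h, hrow⟩

theorem descents_subset_range (T : StandardTableau μ) :
    descents T ⊆ Finset.range (μ.card + 1) := fun _ hi =>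
  Finset.mem_range_succ_iff.mpr (Finset.mem_Icc.mp (Finset.mem_filter.mp hi).1).2

/-- `T` is the standardization of the filling `F`: it numbers the cells by increasing entry of `F`,
and from left to right among equal entries. -/
def Standardizes (T : StandardTableau μ) (F : μ.cells → ℕ) : Prop :=
  ∀ ⦃c c'⦄, T.1 c < T.1 c' → toLex (F c, c.1.2) < toLex (F c', c'.1.2)

namespace Standardizes

variable {T : StandardTableau μ} {F : μ.cells → ℕ}

theorem fiberMonotone (h : T.Standardizes F) :
    FiberMonotone (fun c : μ.cells => c.1.1) (fun c => c.1.2) F :=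
  fun c c' hrow hcol => Prod.Lex.monotone_fst _ _ (h (T.2.1 c c' hrow hcol)).le

theorem fiberStrictMono (h : T.Standardizes F) :
    FiberStrictMono (fun c : μ.cells => c.1.2) (fun c => c.1.1) F := fun c c' hcol hrow => by
  have hlt := Prod.Lex.toLex_lt_toLex.mp (h (T.2.2 c c' hcol hrow))
  exact hlt.resolve_right fun hlt => hlt.2.ne hcol

end Standardizes

theorem standardizes_iff {T : StandardTableau μ} {F : μ.cells → ℕ} :
    T.Standardizes F ↔ ∀ c c', (T.1 c' : ℕ) = T.1 c + 1 →
      F c ≤ F c' ∧ ((T.1 c : ℕ) ∈ descents T → F c < F c') := by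
  have hlex (c c') (h : (T.1 c' : ℕ) = T.1 c + 1) :
      toLex (F c, c.1.2) < toLex (F c', c'.1.2) ↔
        F c ≤ F c' ∧ ((T.1 c : ℕ) ∈ descents T → F c < F c') := by
    rw [T.mem_descents_iff h, Prod.Lex.toLex_lt_toLex]
    dsimp only
    lia
  constructor
  · exact fun hT c c' h => (hlex c c' h).mp (hT (Subtype.coe_lt_coe.mp (by lia)))
  · exact fun hF c c' =>
      T.lt_of_forall_lt_of_apply_eq_succ fun c c' h => (hlex c c' h).mpr (hF c c' h)

theorem existsUnique_standardizes (S : SemistandardYoungTableau μ) :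
    ∃! T : StandardTableau μ, T.Standardizes fun c => S c.1.1 c.1.2 := by
  let key (c : μ.cells) : ℕ ×ₗ ℕ := toLex (S c.1.1 c.1.2, c.1.2)
  have hrow (c c' : μ.cells) (hr : c.1.1 = c'.1.1) (hc : c.1.2 < c'.1.2) : key c < key c' := by
    have h : S c.1.1 c.1.2 ≤ S c'.1.1 c'.1.2 := by simpa [hr] using S.row_weak hc c'.2
    exact Prod.Lex.toLex_lt_toLex.mpr (h.lt_or_eq.imp_right fun h => ⟨h, hc⟩)
  have hcol (c c' : μ.cells) (hc : c.1.2 = c'.1.2) (hr : c.1.1 < c'.1.1) : key c < key c' := by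
    have h := S.col_strict hr c'.2
    exact Prod.Lex.toLex_lt_toLex.mpr (Or.inl (by simpa [hc] using h))
  have hkey : Function.Injective key := fun c c' h => by
    have hc : c.1.2 = c'.1.2 := congrArg (fun x => (ofLex x).2) h
    rcases lt_trichotomy c.1.1 c'.1.1 with hr | hr | hr
    · exact absurd h (hcol c c' hc hr).ne
    · exact Subtype.ext (Prod.ext hr hc)
    · exact absurd h (hcol c' c hc.symm hr).ne'
  obtain ⟨e, he, huniq⟩ := existsUnique_equiv_strictMono_comp_symm
    (β := Finset.Icc 1 μ.card) (by simp [YoungDiagram.card]) hkey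
  have hmono : ∀ c c', key c < key c' ↔ e c < e c' := fun c c' => by
    simpa using he.lt_iff_lt (a := e c) (b := e c')
  refine ⟨⟨e, fun c c' hr hc => (hmono c c').mp (hrow c c' hr hc),
    fun c c' hc hr => (hmono c c').mp (hcol c c' hc hr)⟩,
    fun c c' h => (hmono c c').mpr h, fun T hT => Subtype.ext (huniq T.1 fun i j h => ?_)⟩
  exact hT (by simpa using h)

/-- The standardization of a semistandard tableau. -/
def standardization (S : SemistandardYoungTableau μ) : StandardTableau μ :=
  (existsUnique_standardizes S).choose

theorem standardization_eq_iff {S : SemistandardYoungTableau μ} {T : StandardTableau μ} :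
    standardization S = T ↔ T.Standardizes fun c => S c.1.1 c.1.2 :=
  ⟨fun h => h ▸ (existsUnique_standardizes S).choose_spec.1,
    fun h => ((existsUnique_standardizes S).choose_spec.2 T h).symm⟩

end StandardTableau

end Standardization

section GapSequence

theorem exists_mem_finsuppAntidiag_sum_range_eq {n m : ℕ} {a : ℕ → ℕ} (ha : Monotone a)
    (ha₀ : a 0 = 0) (han : a n ≤ m) :
    ∃ l ∈ (Finset.range (n + 1)).finsuppAntidiag m, ∀ t ≤ n, ∑ r ∈ Finset.range t, l r = a t := by
  let l : ℕ →₀ ℕ := Finsupp.onFinset (Finset.range (n + 1))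
    (fun r => if r < n then a (r + 1) - a r else if r = n then m - a n else 0)
    fun r hr => Finset.mem_range.mpr (by split_ifs at hr <;> lia)
  have hsum : ∀ t ≤ n, ∑ r ∈ Finset.range t, l r = a t := fun t ht => by
    calc ∑ r ∈ Finset.range t, l r
        = ∑ r ∈ Finset.range t, (a (r + 1) - a r) :=
          Finset.sum_congr rfl fun r hr => if_pos ((Finset.mem_range.mp hr).trans_le ht)
      _ = a t := by rw [Finset.sum_range_tsub ha, ha₀, tsub_zero]
  have hlast : l n = m - a n := by simp [l]
  refine ⟨l, Finset.mem_finsuppAntidiag.mpr ⟨?_, Finsupp.support_onFinset_subset⟩, hsum⟩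
  rw [Finset.sum_range_succ, hsum n le_rfl, hlast, Nat.add_sub_cancel' han]

theorem eq_of_sum_range_eq {n m : ℕ} {l l' : ℕ →₀ ℕ}
    (hl : l ∈ (Finset.range (n + 1)).finsuppAntidiag m)
    (hl' : l' ∈ (Finset.range (n + 1)).finsuppAntidiag m)
    (h : ∀ t ≤ n, ∑ r ∈ Finset.range t, l r = ∑ r ∈ Finset.range t, l' r) : l = l' := by
  rw [Finset.mem_finsuppAntidiag] at hl hl'
  have htotal : ∀ t ≤ n + 1, ∑ r ∈ Finset.range t, l r = ∑ r ∈ Finset.range t, l' r :=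
    fun t ht => ht.lt_or_eq.elim (fun ht => h t (Nat.lt_succ_iff.mp ht))
      fun ht => ht ▸ hl.1.trans hl'.1.symm
  ext r
  by_cases hr : r ∈ Finset.range (n + 1)
  · have hr := Finset.mem_range.mp hr
    simpa [Finset.sum_range_succ, htotal r hr.le] using htotal (r + 1) hr
  · rw [Finsupp.notMem_support_iff.mp fun h => hr (hl.2 h),
      Finsupp.notMem_support_iff.mp fun h => hr (hl'.2 h)]

theorem sum_Icc_sub_sum_range {n m : ℕ} {l : ℕ → ℕ} (hl : ∑ r ∈ Finset.range (n + 1), l r = m) :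
    ∑ t ∈ Finset.Icc 1 n, (m - ∑ r ∈ Finset.range t, l r) =
      ∑ r ∈ Finset.range (n + 1), r * l r := by
  calc ∑ t ∈ Finset.Icc 1 n, (m - ∑ r ∈ Finset.range t, l r)
      = ∑ t ∈ Finset.Icc 1 n, ∑ r ∈ Finset.Ico t (n + 1), l r :=
        Finset.sum_congr rfl fun t ht => by
          have ht : t ≤ n + 1 := (Finset.mem_Icc.mp ht).2.trans n.le_succ
          rw [← hl, ← Finset.sum_range_add_sum_Ico l ht, Nat.add_sub_cancel_left]
    _ = ∑ r ∈ Finset.range (n + 1), ∑ _t ∈ Finset.Icc 1 r, l r :=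
        Finset.sum_comm' fun t r => by
          simp only [Finset.mem_Icc, Finset.mem_Ico, Finset.mem_range]
          lia
    _ = ∑ r ∈ Finset.range (n + 1), r * l r := by simp

variable {μ : YoungDiagram}

namespace StandardTableau

/-- The filling of `μ` whose entries, listed in the order of `T`, are the partial sums of `l`: it
starts from `0` and jumps by `l r` between the `r`-th cell and the next one. -/
def gapFilling (T : StandardTableau μ) (l : ℕ → ℕ) (c : μ.cells) : ℕ :=
  ∑ r ∈ Finset.range (T.1 c), l r

theorem standardizes_gapFilling_iff {T : StandardTableau μ} {l : ℕ → ℕ} :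
    T.Standardizes (T.gapFilling l) ↔ ∀ j ∈ descents T, l j ≠ 0 := by
  have hstep {c c' : μ.cells} (h : (T.1 c' : ℕ) = T.1 c + 1) :
      T.gapFilling l c' = T.gapFilling l c + l (T.1 c) := by
    rw [gapFilling, h, Finset.sum_range_succ, gapFilling]
  rw [standardizes_iff]
  constructor
  · intro hT j hj
    obtain ⟨-, c, c', rfl, hc', -⟩ := Finset.mem_filter.mp hj
    have hlt := (hT c c' hc').2 hj
    rw [hstep hc'] at hlt
    lia
  · intro hl c c' h
    have := hl (T.1 c)
    rw [hstep h]
    lia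

theorem gapFilling_le {T : StandardTableau μ} {m : ℕ} {l : ℕ → ℕ}
    (hl : ∑ r ∈ Finset.range (μ.card + 1), l r = m) (c : μ.cells) : T.gapFilling l c ≤ m :=
  hl ▸ Finset.sum_le_sum_of_subset
    (Finset.range_mono ((T.apply_mem_Icc c).2.trans (Nat.le_succ _)))

theorem gapFilling_injOn (T : StandardTableau μ) (m : ℕ) :
    Set.InjOn (fun l : ℕ →₀ ℕ => T.gapFilling l)
      ((Finset.range (μ.card + 1)).finsuppAntidiag m) := by
  intro l hl l' hl' h
  refine eq_of_sum_range_eq hl hl' fun t ht => ?_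
  rcases Nat.eq_zero_or_pos t with rfl | ht₁
  · rfl
  · obtain ⟨c, rfl⟩ := T.exists_apply_eq ht₁ ht
    exact congrFun h c

theorem exists_gapFilling_eq {T : StandardTableau μ} {F : μ.cells → ℕ} {m : ℕ}
    (hT : T.Standardizes F) (hF : ∀ c, F c ≤ m) :
    ∃ l ∈ (Finset.range (μ.card + 1)).finsuppAntidiag m, T.gapFilling l = F := by
  have hmono {c c' : μ.cells} (h : (T.1 c : ℕ) ≤ T.1 c') : F c ≤ F c' := by
    rcases h.eq_or_lt with h | h
    · rw [T.1.injective (Subtype.ext h)]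
    · exact Prod.Lex.monotone_fst _ _ (hT h).le
  let a (t : ℕ) : ℕ := {c : μ.cells | (T.1 c : ℕ) ≤ t}.toFinset.sup F
  obtain ⟨l, hl, hsum⟩ := exists_mem_finsuppAntidiag_sum_range_eq (n := μ.card) (m := m) (a := a)
    (fun t t' h => Finset.sup_mono fun c hc => by
      simp only [Set.mem_toFinset, Set.mem_ofPred_eq] at hc ⊢
      exact hc.trans h)
    (by
      refine Nat.le_zero.mp (Finset.sup_le fun c hc => ?_)
      have := T.apply_mem_Icc c
      simp only [Set.mem_toFinset, Set.mem_ofPred_eq] at hc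
      lia)
    (Finset.sup_le fun c _ => hF c)
  refine ⟨l, hl, funext fun c => (hsum _ (T.apply_mem_Icc c).2).trans (le_antisymm ?_ ?_)⟩
  · exact Finset.sup_le fun c' hc' => hmono (by simpa using hc')
  · exact Finset.le_sup (f := F) (by simp)

theorem sum_sub_gapFilling (T : StandardTableau μ) {m : ℕ} {l : ℕ → ℕ}
    (hl : ∑ r ∈ Finset.range (μ.card + 1), l r = m) :
    ∑ c : μ.cells, (m - T.gapFilling l c) = ∑ r ∈ Finset.range (μ.card + 1), r * l r := by
  rw [← sum_Icc_sub_sum_range hl, ← Finset.sum_coe_sort (Finset.Icc 1 μ.card)]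
  exact Fintype.sum_equiv T.1 _ _ fun _ => rfl

theorem sum_standardization_eq (T : StandardTableau μ) {M : Type*} [AddCommMonoid M] (m : ℕ)
    (f : ℕ → M) :
    ∑ S : BoundedSSYT μ (m + 1) with standardization S.1 = T,
        f (∑ c : μ.cells, (m - S.1 c.1.1 c.1.2)) =
      ∑ l ∈ (Finset.range (μ.card + 1)).finsuppAntidiag m with ∀ j ∈ descents T, l j ≠ 0,
        f (∑ r ∈ Finset.range (μ.card + 1), r * l r) := by
  classical
  symm
  have hstd {l : ℕ →₀ ℕ} (hl : ∀ j ∈ descents T, l j ≠ 0) : T.Standardizes (T.gapFilling l) :=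
    standardizes_gapFilling_iff.mpr hl
  have hmem {l : ℕ →₀ ℕ} (hl : l ∈ (Finset.range (μ.card + 1)).finsuppAntidiag m) :=
    (Finset.mem_finsuppAntidiag.mp hl).1
  refine Finset.sum_bij (fun l hl => ⟨ofFilling (T.gapFilling l)
    (hstd (Finset.mem_filter.mp hl).2).fiberMonotone
    (hstd (Finset.mem_filter.mp hl).2).fiberStrictMono, fun c => ?_⟩) ?_ ?_ ?_ ?_
  · rw [ofFilling_apply]
    exact Nat.lt_succ_of_le (gapFilling_le (hmem (Finset.mem_filter.mp hl).1) c)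
  · intro l hl
    refine Finset.mem_filter.mpr ⟨Finset.mem_univ _, standardization_eq_iff.mpr ?_⟩
    simpa only [ofFilling_apply] using hstd (Finset.mem_filter.mp hl).2
  · intro l hl l' hl' h
    refine T.gapFilling_injOn m (Finset.mem_filter.mp hl).1 (Finset.mem_filter.mp hl').1
      (funext fun c => ?_)
    simpa only [ofFilling_apply] using
      congrArg (fun S : BoundedSSYT μ (m + 1) => S.1 c.1.1 c.1.2) h
  · intro S hS
    have hT := standardization_eq_iff.mp (Finset.mem_filter.mp hS).2
    obtain ⟨l, hl, hlS⟩ := exists_gapFilling_eq hT fun c => Nat.le_of_lt_succ (S.2 c)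
    refine ⟨l, Finset.mem_filter.mpr ⟨hl, standardizes_gapFilling_iff.mp (hlS ▸ hT)⟩, ?_⟩
    refine Subtype.ext (semistandardYoungTableau_ext_cells fun c => ?_)
    rw [ofFilling_apply, hlS]
  · intro l hl
    simp only [ofFilling_apply, T.sum_sub_gapFilling (hmem (Finset.mem_filter.mp hl).1)]

end StandardTableau

end GapSequence

section GeneratingFunction

open PowerSeries

theorem mk_ite_pow_mul_one_sub {R : Type*} [CommRing R] (a : R) (p : Prop) [Decidable p] :
    mk (fun n => if p ∧ n = 0 then 0 else a ^ n) * (1 - C a * X) = if p then C a * X else 1 := by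
  ext n
  rw [mul_one_sub, mul_left_comm, ← mul_assoc, map_sub]
  rcases n with _ | _ | n <;> split_ifs with hp <;> simp [hp, pow_succ', coeff_X, coeff_one]

theorem mk_sum_finsuppAntidiag_mul_prod {ι R : Type*} [DecidableEq ι] [CommRing R]
    {D s : Finset ι} (hD : D ⊆ s) (a : ι → R) :
    mk (fun m => ∑ l ∈ s.finsuppAntidiag m with ∀ j ∈ D, l j ≠ 0, ∏ j ∈ s, a j ^ l j) *
      ∏ j ∈ s, (1 - C (a j) * X) = ∏ j ∈ D, (C (a j) * X) := by
  have hfactor : mk (fun m => ∑ l ∈ s.finsuppAntidiag m with ∀ j ∈ D, l j ≠ 0,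
      ∏ j ∈ s, a j ^ l j) = ∏ j ∈ s, mk fun n => if j ∈ D ∧ n = 0 then 0 else a j ^ n := by
    ext m
    rw [coeff_mk, coeff_prod, Finset.sum_filter]
    refine Finset.sum_congr rfl fun l _ => ?_
    simp only [coeff_mk]
    split_ifs with hl
    · exact Finset.prod_congr rfl fun j _ => (if_neg fun h => hl j h.1 h.2).symm
    · push Not at hl
      obtain ⟨j, hj, hlj⟩ := hl
      refine (Finset.prod_eq_zero (hD hj) ?_).symm
      exact if_pos ⟨hj, hlj⟩
  rw [hfactor, ← Finset.prod_mul_distrib]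
  simp only [mk_ite_pow_mul_one_sub]
  rw [Finset.prod_ite_mem, Finset.inter_eq_right.mpr hD]

theorem mk_principalSchur_mul (μ : YoungDiagram) :
    mk (fun m => principalSchur μ m) *
        ∏ i ∈ Finset.range (μ.card + 1), (1 - C ((Polynomial.X : Polynomial ℤ) ^ i) * X) =
      ∑ T : StandardTableau μ, X ^ des T * C ((Polynomial.X : Polynomial ℤ) ^ maj T) := by
  classical
  have hschur : mk (fun m => principalSchur μ m) = ∑ T : StandardTableau μ, mk fun m =>
      ∑ l ∈ (Finset.range (μ.card + 1)).finsuppAntidiag m with ∀ j ∈ descents T, l j ≠ 0,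
        ∏ r ∈ Finset.range (μ.card + 1), ((Polynomial.X : Polynomial ℤ) ^ r) ^ l r := by
    ext1 m
    simp only [map_sum, coeff_mk, principalSchur_eq_sum_sub, ← pow_mul,
      Finset.prod_pow_eq_pow_sum]
    simp only [← StandardTableau.sum_standardization_eq _ m
      fun n => (Polynomial.X : Polynomial ℤ) ^ n]
    exact (Finset.sum_fiberwise _ (fun S : BoundedSSYT μ (m + 1) =>
      StandardTableau.standardization S.1) _).symm
  rw [hschur, Finset.sum_mul]
  refine Finset.sum_congr rfl fun T _ => ?_
  rw [mk_sum_finsuppAntidiag_mul_prod T.descents_subset_range, Finset.prod_mul_distrib,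
    Finset.prod_const, ← map_prod, Finset.prod_pow_eq_pow_sum, mul_comm, des, maj]

end GeneratingFunction

end

end Covariants

theorem mainTheorem6_general (k : Type*) [Field k] [CharZero k] (d : ℕ)
    (μ : YoungDiagram) (T : μ.cells ≃ Fin d) :
    Covariants.equivariantHilbertSeries k T =
        PowerSeries.mk (fun m => Covariants.principalSchur μ m) ∧
      PowerSeries.mk (fun m => Covariants.principalSchur μ m) *
          ∏ i ∈ Finset.range (d + 1),
            (1 - PowerSeries.C ((Polynomial.X : Polynomial ℤ) ^ i) * PowerSeries.X) =
        ∑ S : Covariants.StandardTableau μ,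
          PowerSeries.X ^ Covariants.des S *
            PowerSeries.C ((Polynomial.X : Polynomial ℤ) ^ Covariants.maj S) := by
  have hcard : μ.card = d := Finset.card_eq_of_equiv_fin T
  refine ⟨congrArg PowerSeries.mk (funext fun m => Covariants.character_eq_principalSchur T m), ?_⟩
  exact hcard ▸ Covariants.mk_principalSchur_mul μ

/-- The last equality is cleared of its denominator `∏_{i=0}^d (1 - q^i t)`, a unit of `ℤ[q]⟦t⟧`
(its constant term is `1`). Here `q = Polynomial.X` and `t = PowerSeries.X`. The representation
`V_μ` is built from an arbitrary numbering `T` of the cells of `μ`. -/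
theorem mainTheorem6 (k : Type*) [Field k] [IsAlgClosed k] [CharZero k] (d : ℕ)
    (μ : YoungDiagram) (hμ : μ.card = d) (T : μ.cells ≃ Fin d) :
    Covariants.equivariantHilbertSeries k T =
        PowerSeries.mk (fun m => Covariants.principalSchur μ m) ∧
      PowerSeries.mk (fun m => Covariants.principalSchur μ m) *
          ∏ i ∈ Finset.range (d + 1),
            (1 - PowerSeries.C ((Polynomial.X : Polynomial ℤ) ^ i) * PowerSeries.X) =
        ∑ S : Covariants.StandardTableau μ,
          PowerSeries.X ^ Covariants.des S *
            PowerSeries.C ((Polynomial.X : Polynomial ℤ) ^ Covariants.maj S) := by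
  exact mainTheorem6_general k d μ T
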